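/- Let $c_1,\dots,c_n$ be linearly independent vectors in $\mathbb R^n$, let $\mathbb T^n=\langle y\mapsto y+c_1,\dots,y\mapsto y+c_n\rangle\backslash\mathbb R^n$, and let $X=\mathbb R_r\times\mathbb T^n_y$. For $R_g>0$ call a function $\beta\in C^\infty(\mathbb R;\mathbb R)$ \emph{admissible} if for some $\theta_0\in(0,\pi/4)$ it extends from $\{r\in\mathbb R:|r|>R_g\}$ to a bounded holomorphic function on the sectors $\{z\in\mathbb C:|z|>R_g,\ \min\{|\arg z|,|\arg(-z)|\}<2\theta_0\}$, and $|\beta'(r)|+|\beta''(r)|\le 1/4$ for all $r\in\mathbb R$. Say that a smooth Riemannian metric $g$ on $X$ \emph{satisfies the assumptions with the constant $R_g>0$} if (a) $g|_{\{\pm r>R_g\}}=dr^2+e^{2(r+\beta(r))}dS_\pm$ for some admissible $\beta$ and some smooth Riemannian metrics $dS_+,dS_-$ on $\mathbb T^n$; (b) every maximally extended geodesic is defined on all of $\mathbb R$, and every nonconstant geodesic $\gamma\colon\mathbb R\to X$ has unbounded image $\gamma(\mathbb R)$ (with respect to the Riemannian distance of $g$); (c) for every nonconstant geodesic $\gamma\colon\mathbb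 R\to X$ the time set $\gamma^{-1}(\{r<-R_g\})$ that it spends in the cusp is connected (possibly empty). 1. Let $R_g>0$, let $\beta$ be admissible, and let $g$ be a smooth Riemannian metric on $X$ with $g=dr^2+e^{2(r+\beta(r))}dy^2$ on $\{|r|>R_g\}$, where $dy^2$ is the flat metric, and with all sectional curvatures nonpositive at the points of $\{|r|\le R_g\}$. Then $g$ satisfies the assumptions with the constant $R_g$; in particular every nonconstant geodesic is unbounded and enters the cusp $\{r<-R_g\}$ in a connected time set. 2. Let $g$ be a smooth Riemannian metric with nonpositive sectional curvatures on $\langle z\mapsto z+1\rangle\backslash\mathbb H^2$, that is, on $\mathbb R_r\times(\mathbb R/\mathbb Z)_y$ with $z=y+ie^{-r}$, which coincides with the hyperbolic metric $dr^2+e^{2r}dy^2$ outside a compact set. Then there is $R_g>0$ such that $g$ satisfies the assumptions with the constant $R_g$. -/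

import Mathlib

open scoped ContDiff ENNReal

noncomputable section

namespace CuspFunnel

/-- The universal cover `ℝ × ℝⁿ` of `ℝ × 𝕋ⁿ`, with coordinates `(r, y)`. It also serves as the
tangent space at each of its points, and at each point of the quotient. -/
abbrev Cover (n : ℕ) : Type := ℝ × EuclideanSpace ℝ (Fin n)

/-- The group of translations generated by `y ↦ y + c₁, …, y ↦ y + cₙ`. -/
abbrev lattice {n : ℕ} (c : Fin n → EuclideanSpace ℝ (Fin n)) :
    AddSubgroup (EuclideanSpace ℝ (Fin n)) :=
  AddSubgroup.closure (Set.range c)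

/-- The torus `⟨y ↦ y + c₁, …, y ↦ y + cₙ⟩ \ ℝⁿ`. -/
abbrev Torus {n : ℕ} (c : Fin n → EuclideanSpace ℝ (Fin n)) : Type :=
  EuclideanSpace ℝ (Fin n) ⧸ lattice c

/-- The manifold `X = ℝ × 𝕋ⁿ`. -/
abbrev Cylinder {n : ℕ} (c : Fin n → EuclideanSpace ℝ (Fin n)) : Type :=
  ℝ × Torus c

/-- The covering map `ℝ × ℝⁿ → ℝ × 𝕋ⁿ`. -/
def proj {n : ℕ} (c : Fin n → EuclideanSpace ℝ (Fin n)) (x : Cover n) : Cylinder c :=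
  (x.1, (x.2 : Torus c))

/-- A smooth Riemannian metric on `X = ℝ × 𝕋ⁿ`. The tangent bundle of `X` is canonically trivial,
so a metric is a family of inner products on `ℝ × ℝⁿ` indexed by the points of `X`; it is smooth
if its pullback by the covering map (a local diffeomorphism) is. -/
structure Metric {n : ℕ} (c : Fin n → EuclideanSpace ℝ (Fin n)) where
  form : Cylinder c → Cover n →L[ℝ] Cover n →L[ℝ] ℝ
  smooth : ContDiff ℝ ∞ (fun x : Cover n => form (proj c x))
  symm : ∀ p u v, form p u v = form p v u
  pos : ∀ p u, u ≠ 0 → 0 < form p u u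

/-- A smooth Riemannian metric on the torus. -/
structure TorusMetric {n : ℕ} (c : Fin n → EuclideanSpace ℝ (Fin n)) where
  form : Torus c → EuclideanSpace ℝ (Fin n) →L[ℝ] EuclideanSpace ℝ (Fin n) →L[ℝ] ℝ
  smooth : ContDiff ℝ ∞ (fun y : EuclideanSpace ℝ (Fin n) => form (y : Torus c))
  symm : ∀ p u v, form p u v = form p v u
  pos : ∀ p u, u ≠ 0 → 0 < form p u u

namespace Metric

variable {n : ℕ} {c : Fin n → EuclideanSpace ℝ (Fin n)}

/-- The metric lifted to the universal cover. -/
def lift (g : Metric c) (x : Cover n) : Cover n →L[ℝ] Cover n →L[ℝ] ℝ :=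
  g.form (proj c x)

/-- The Christoffel symbols `Γ_x(u, v) = uᵝ vᵞ Γᵅ_{βγ}(x)` of the lifted metric: the vector with
`2 g(Γ(u, v), z) = (∂_u g)(v, z) + (∂_v g)(u, z) - (∂_z g)(u, v)` for all `z`. -/
def christoffel (g : Metric c) (x u v : Cover n) : Cover n :=
  (1 / 2 : ℝ) • (g.lift x).inverse
    (fderiv ℝ g.lift x u v + fderiv ℝ g.lift x v u - ((fderiv ℝ g.lift x).flip u).flip v)

/-- The Riemann curvature tensor `R(u, v) w` of the lifted metric. -/
def curvature (g : Metric c) (x u v w : Cover n) : Cover n :=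
  fderiv ℝ (fun p => g.christoffel p v w) x u - fderiv ℝ (fun p => g.christoffel p u w) x v
    + g.christoffel x u (g.christoffel x v w) - g.christoffel x v (g.christoffel x u w)

/-- The sectional curvature of the plane spanned by linearly independent `u, v`. -/
def sectionalCurvature (g : Metric c) (x u v : Cover n) : ℝ :=
  g.lift x (g.curvature x u v v) u /
    (g.lift x u u * g.lift x v v - g.lift x u v ^ 2)

/-- All sectional curvatures are nonpositive at the points of `X` whose `r`-coordinate is
in `A`. -/
def NonposCurvedOver (g : Metric c) (A : Set ℝ) : Prop :=
  ∀ x : Cover n, x.1 ∈ A → ∀ u v : Cover n, LinearIndependent ℝ ![u, v] →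
    g.sectionalCurvature x u v ≤ 0

/-- The geodesic equation `x'' + Γ_x(x', x') = 0` on the universal cover, on the time set `ℝ`. -/
def IsLiftedGeodesic (g : Metric c) (x : ℝ → Cover n) : Prop :=
  ∃ v : ℝ → Cover n, (∀ t, HasDerivAt x (v t) t) ∧
    ∀ t, HasDerivAt v (-g.christoffel (x t) (v t) (v t)) t

/-- Geodesics `ℝ → X`, constant ones included: the projections of the geodesics of the lifted
metric. -/
def IsGeodesic (g : Metric c) (γ : ℝ → Cylinder c) : Prop :=
  ∃ x : ℝ → Cover n, g.IsLiftedGeodesic x ∧ ∀ t, γ t = proj c (x t)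

/-- The length of the projection to `X` of a curve `x : [0, 1] → ℝ × ℝⁿ`. -/
def length (g : Metric c) (x : ℝ → Cover n) : ℝ≥0∞ :=
  ∫⁻ t in Set.Icc (0 : ℝ) 1,
    ENNReal.ofReal (Real.sqrt (g.lift (x t) (deriv x t) (deriv x t)))

/-- The Riemannian distance `d_g` on `X`: the infimum of the lengths of `C¹` curves (every such
curve in `X` lifts to the universal cover). -/
def riemDist (g : Metric c) (p q : Cylinder c) : ℝ≥0∞ :=
  ⨅ (x : ℝ → Cover n) (_ : ContDiff ℝ 1 x ∧ proj c (x 0) = p ∧ proj c (x 1) = q), g.length x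

/-- Boundedness of a subset of `X` with respect to `d_g`. -/
def IsBounded (g : Metric c) (A : Set (Cylinder c)) : Prop :=
  ∃ C : ℝ≥0∞, C < ⊤ ∧ ∀ p ∈ A, ∀ q ∈ A, g.riemDist p q ≤ C

end Metric

/-- The sectors `|z| > R`, `min {|arg z|, |arg (-z)|} < 2 θ` around the two real half-lines. -/
def sectors (R θ : ℝ) : Set ℂ :=
  {z | R < ‖z‖ ∧ min |z.arg| |(-z).arg| < 2 * θ}

/-- The assumptions on the function `β`: it is smooth on `ℝ`, it is (that is, its restriction to
`|r| > R` extends to be) holomorphic and bounded in sectors, and `|β'| + |β''| ≤ 1/4` on `ℝ`. -/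
structure Admissible (β : ℝ → ℝ) (R : ℝ) : Prop where
  smooth : ContDiff ℝ ∞ β
  holomorphic : ∃ θ : ℝ, 0 < θ ∧ θ < Real.pi / 4 ∧ ∃ B : ℂ → ℂ,
    DifferentiableOn ℂ B (sectors R θ) ∧ (∃ M : ℝ, ∀ z ∈ sectors R θ, ‖B z‖ ≤ M) ∧
    ∀ r : ℝ, R < |r| → B (r : ℂ) = (β r : ℂ)
  small : ∀ r : ℝ, |deriv β r| + |deriv (deriv β) r| ≤ 1 / 4

/-- The full set of assumptions on a metric on `X = ℝ × 𝕋ⁿ` with cusp `{r < -R}` and funnel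
`{r > R}`: the form of the metric in the two ends, and the dynamical assumptions on maximally
extended geodesics, which are defined on all of `ℝ` by the field `complete`. -/
structure Assumptions {n : ℕ} {c : Fin n → EuclideanSpace ℝ (Fin n)} (g : Metric c) (R : ℝ) :
    Prop where
  R_pos : 0 < R
  ends : ∃ (β : ℝ → ℝ) (Splus Sminus : TorusMetric c), Admissible β R ∧
    (∀ p : Cylinder c, R < p.1 → ∀ u v : Cover n, g.form p u v =
      u.1 * v.1 + Real.exp (2 * (p.1 + β p.1)) * Splus.form p.2 u.2 v.2) ∧
    (∀ p : Cylinder c, p.1 < -R → ∀ u v : Cover n, g.form p u v =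
      u.1 * v.1 + Real.exp (2 * (p.1 + β p.1)) * Sminus.form p.2 u.2 v.2)
  complete : ∀ x v : Cover n, ∃ γ : ℝ → Cover n,
    g.IsLiftedGeodesic γ ∧ γ 0 = x ∧ deriv γ 0 = v
  unbounded : ∀ γ : ℝ → Cylinder c, g.IsGeodesic γ → (∃ s t, γ s ≠ γ t) →
    ¬ g.IsBounded (Set.range γ)
  connected : ∀ γ : ℝ → Cylinder c, g.IsGeodesic γ → (∃ s t, γ s ≠ γ t) →
    IsPreconnected (γ ⁻¹' {p | p.1 < -R})

/-- The inner product `dr² + e^{2(r + b)} dy²` on `ℝ × ℝⁿ`. -/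
def warpedForm {n : ℕ} (r b : ℝ) (u v : Cover n) : ℝ :=
  u.1 * v.1 + Real.exp (2 * (r + b)) * inner ℝ u.2 v.2

/-- The generator of the lattice `ℤ` in `ℝ`. The cylinder `ℝ × (ℝ / ℤ)` with the metric
`dr² + e^{2r} dy²` is `⟨z ↦ z + 1⟩ \ ℍ²` in the coordinates `z = y + i e^{-r}`. -/
def unitTranslation : Fin 1 → EuclideanSpace ℝ (Fin 1) := fun _ => EuclideanSpace.single 0 1

end CuspFunnel

end

/-! The key is a function that is convex along geodesics and has the cusp as a sublevel set. The
curvature is nonpositive everywhere: by hypothesis where |r| ≤ R, and in the ends because f =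
e^{r+β} satisfies f''/f = β'' + (1+β')² ≥ 9/16 - 1/4 (`Metric.curvature_nonpos`). On the universal
cover, the vertical lines of the cusp are continued as unit speed geodesics, which gives a map Φ(s,
y) equal to the identity for s < -R (`exists_normalCoordinates`). The Jacobi fields J = ∂Φ/∂y are
orthogonal to N = ∂Φ/∂s, so Φ pulls g back to ds² + g(J, J). Along each line g(∇J, J) is
nondecreasing by nonpositive curvature and positive in the cusp, where 1 + β' > 0. Hence it is
positive throughout and g(J, J) grows (`form_covJ_J_pos`, `monotone_form_J_J`). So Φ is a local
homeomorphism, the growth of J lets segments lift through it, and it is a homeomorphism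
(`exists_inverse`).

Along a geodesic the height s has second derivative g(∇J, J) ≥ 0, where J comes from the
horospherical part of the velocity (`exists_height_derivs`). Convexity makes the time set {s < -R}
connected. On a bounded geodesic r is bounded, hence so is s, because s is lattice invariant and the
torus is compact. A bounded function on ℝ with monotone derivative is constant, so both the
derivative of s and g(∇J, J) vanish, and the geodesic is constant.

Geodesics are complete because speed is conserved and g ≥ m dr²: in finite time r stays bounded, and
over bounded r the metric dominates a multiple of the Euclidean one (`noBlowUp_geodesicField`). The
second claim is the first with n = 1 and β = 0. -/

open scoped ContDiff ENNReal

noncomputable section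

namespace CuspFunnel

/-! ### Global flows of vector fields without blow-up, and their differentiability -/

section ODE

open Set _root_.Metric Filter Topology

variable {E : Type*} [NormedAddCommGroup E] [NormedSpace ℝ E]

/-- Two-sided Grönwall inequality around the time `0`. -/
theorem norm_le_gronwallBound_abs {u u' : ℝ → E} {T K ε : ℝ}
    (h : ∀ t ∈ Ioo (-T) T, HasDerivAt u (u' t) t)
    (hb : ∀ t ∈ Ioo (-T) T, ‖u' t‖ ≤ K * ‖u t‖ + ε) :
    ∀ t ∈ Ioo (-T) T, ‖u t‖ ≤ gronwallBound ‖u 0‖ K ε |t| := by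
  intro t ht
  rcases le_total 0 t with h0 | h0
  · have hsub : ∀ s ∈ Icc 0 t, s ∈ Ioo (-T) T := fun s hs => ⟨by linarith [ht.2, hs.1, hs.2],
      by linarith [ht.2, hs.2]⟩
    have := norm_le_gronwallBound_of_norm_deriv_right_le (f := u) (f' := u') (δ := ‖u 0‖) (K := K)
      (ε := ε) (a := 0) (b := t) (fun s hs => (h s (hsub s hs)).continuousAt.continuousWithinAt)
      (fun s hs => (h s (hsub s (Ico_subset_Icc_self hs))).hasDerivWithinAt) le_rfl
      (fun s hs => hb s (hsub s (Ico_subset_Icc_self hs))) t ⟨h0, le_rfl⟩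
    rw [abs_of_nonneg h0]; rwa [sub_zero] at this
  · have hsub : ∀ s ∈ Icc 0 (-t), -s ∈ Ioo (-T) T := fun s hs => ⟨by linarith [ht.1, hs.2],
      by linarith [ht.1, hs.1, hs.2]⟩
    have hd : ∀ s ∈ Icc 0 (-t), HasDerivAt (fun s => u (-s)) (-u' (-s)) s := fun s hs => by
      simpa [Function.comp_def] using (h (-s) (hsub s hs)).scomp s (hasDerivAt_neg s)
    have := norm_le_gronwallBound_of_norm_deriv_right_le (f := fun s => u (-s))
      (f' := fun s => -u' (-s)) (δ := ‖u 0‖) (K := K)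
      (ε := ε) (a := 0) (b := -t) (fun s hs => (hd s hs).continuousAt.continuousWithinAt)
      (fun s hs => (hd s (Ico_subset_Icc_self hs)).hasDerivWithinAt) (by simp)
      (fun s hs => by simpa using hb (-s) (hsub s (Ico_subset_Icc_self hs))) (-t)
      ⟨by linarith, le_rfl⟩
    rw [abs_of_nonpos h0]; rwa [sub_zero, neg_neg] at this

/-- Solutions of `x' = f x` do not blow up in finite time, uniformly for bounded initial data. -/
def NoBlowUp (f : E → E) : Prop :=
  ∀ T ρ : ℝ, ∃ M : ℝ, ∀ T' ≤ T, ∀ α : ℝ → E,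
    (∀ t ∈ Ioo (-T') T', HasDerivAt α (f (α t)) t) → ‖α 0‖ ≤ ρ →
      ∀ t ∈ Ioo (-T') T', ‖α t‖ ≤ M

/-- A global flow of the vector field `f`. -/
structure IsFlow (f : E → E) (F : ℝ → E → E) : Prop where
  zero : ∀ x, F 0 x = x
  deriv : ∀ x t, HasDerivAt (fun t => F t x) (f (F t x)) t

variable [FiniteDimensional ℝ E]

set_option linter.unusedSectionVars false

theorem exists_lipschitzOnWith_closedBall {F : Type*} [NormedAddCommGroup F] [NormedSpace ℝ F]
    {f : E → F} (hf : ContDiff ℝ 1 f) (M : ℝ) :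
    ∃ K, LipschitzOnWith K f (closedBall (0 : E) M) :=
  have := FiniteDimensional.proper ℝ E
  hf.contDiffOn.exists_lipschitzOnWith one_ne_zero (convex_closedBall 0 M)
    (isCompact_closedBall 0 M)

theorem exists_norm_fderiv_le_closedBall {f : E → E} (hf : ContDiff ℝ 1 f) (M : ℝ) :
    ∃ L, 0 < L ∧ ∀ x ∈ closedBall (0 : E) M, ‖fderiv ℝ f x‖ ≤ L := by
  have := FiniteDimensional.proper ℝ E
  obtain ⟨C, hC⟩ := (isCompact_closedBall (0 : E) M).exists_bound_of_continuousOn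
    (hf.continuous_fderiv one_ne_zero).continuousOn
  exact ⟨max C 1, by positivity, fun x hx => (hC x hx).trans (le_max_left _ _)⟩

/-- Integral curves of a `C¹` vector field on an interval are determined by one value. -/
theorem integralCurve_eqOn_Ioo {f : E → E} (hf : ContDiff ℝ 1 f) {α α' : ℝ → E} {a b t₀ : ℝ}
    (ht₀ : t₀ ∈ Ioo a b) (hα : ∀ t ∈ Ioo a b, HasDerivAt α (f (α t)) t)
    (hα' : ∀ t ∈ Ioo a b, HasDerivAt α' (f (α' t)) t) (h : α t₀ = α' t₀) :
    EqOn α α' (Ioo a b) := by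
  intro t ht
  -- On a compact subinterval both curves stay in one ball, where the field is Lipschitz.
  obtain ⟨a', ha1, ha2⟩ := exists_between (lt_min ht₀.1 ht.1)
  obtain ⟨b', hb1, hb2⟩ := exists_between (max_lt ht₀.2 ht.2)
  have hsub : Icc a' b' ⊆ Ioo a b := fun s hs => ⟨ha1.trans_le hs.1, hs.2.trans_lt hb2⟩
  obtain ⟨C, hC⟩ := isCompact_Icc.exists_bound_of_continuousOn
    (fun s hs => (hα s (hsub hs)).continuousAt.continuousWithinAt : ContinuousOn α (Icc a' b'))
  obtain ⟨C', hC'⟩ := isCompact_Icc.exists_bound_of_continuousOn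
    (fun s hs => (hα' s (hsub hs)).continuousAt.continuousWithinAt : ContinuousOn α' (Icc a' b'))
  obtain ⟨K, hK⟩ := exists_lipschitzOnWith_closedBall hf (max C C')
  exact ODE_solution_unique_of_mem_Ioo (v := fun _ => f) (s := fun _ => closedBall 0 (max C C'))
    (a := a') (b := b') (t₀ := t₀) (fun _ _ => hK) ⟨(lt_min_iff.1 ha2).1, (max_lt_iff.1 hb1).1⟩
    (fun s hs => ⟨hα s (hsub (Ioo_subset_Icc_self hs)),
      by simpa using Or.inl (hC s (Ioo_subset_Icc_self hs))⟩)
    (fun s hs => ⟨hα' s (hsub (Ioo_subset_Icc_self hs)),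
      by simpa using Or.inr (hC' s (Ioo_subset_Icc_self hs))⟩) h
    ⟨(lt_min_iff.1 ha2).2, (max_lt_iff.1 hb1).2⟩

theorem integralCurve_eq {f : E → E} (hf : ContDiff ℝ 1 f) {α α' : ℝ → E} {t₀ : ℝ}
    (hα : ∀ t, HasDerivAt α (f (α t)) t) (hα' : ∀ t, HasDerivAt α' (f (α' t)) t)
    (h : α t₀ = α' t₀) (t : ℝ) : α t = α' t :=
  integralCurve_eqOn_Ioo hf (a := min t t₀ - 1) (b := max t t₀ + 1) (t₀ := t₀)
    ⟨by linarith [min_le_right t t₀], by linarith [le_max_right t t₀]⟩ (fun s _ => hα s)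
    (fun s _ => hα' s) h ⟨by linarith [min_le_left t t₀], by linarith [le_max_left t t₀]⟩

/-- A cutoff makes the field bounded and globally Lipschitz, so Picard–Lindelöf applies on all of
[-T, T]. The a priori bound then keeps the solution where the cutoff is 1. -/
theorem NoBlowUp.exists_integralCurve_Ioo {f : E → E} (hb : NoBlowUp f) (hf : ContDiff ℝ 1 f)
    (x : E) (T : ℝ) (hT : 0 < T) :
    ∃ α : ℝ → E, α 0 = x ∧ ∀ t ∈ Ioo (-T) T, HasDerivAt α (f (α t)) t := by
  have := FiniteDimensional.proper ℝ E
  obtain ⟨M₀, hM₀⟩ := hb T ‖x‖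
  set M := max M₀ ‖x‖ with hM
  have hMx : ‖x‖ ≤ M := le_max_right _ _
  have hM0 : 0 ≤ M := (norm_nonneg x).trans hMx
  let χ : ContDiffBump (0 : E) := ⟨M + 1, M + 2, by linarith, by linarith⟩
  let f' : E → E := fun y => χ y • f y
  have hf' : ContDiff ℝ 1 f' := χ.contDiff.smul hf
  have hsupp : HasCompactSupport f' := χ.hasCompactSupport.smul_right
  obtain ⟨K, hK⟩ := hf'.lipschitzWith_of_hasCompactSupport hsupp one_ne_zero
  obtain ⟨C, hC⟩ := hsupp.exists_bound_of_continuous hf'.continuous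
  have hC0 : 0 ≤ C := (norm_nonneg _).trans (hC 0)
  have hPL : IsPicardLindelof (fun _ => f') (⟨0, by constructor <;> linarith⟩ : Icc (-T) T) x
      (C.toNNReal * T.toNNReal) 0 C.toNNReal K :=
    { lipschitzOnWith := fun _ _ => hK.lipschitzOnWith
      continuousOn := fun _ _ => continuousOn_const
      norm_le := fun _ _ y _ => by simpa [Real.coe_toNNReal C hC0] using hC y
      mul_max_le := by simp [hT.le] }
  obtain ⟨α, hα0, hα⟩ := hPL.exists_eq_forall_mem_Icc_hasDerivWithinAt₀
  have hα' : ∀ t ∈ Ioo (-T) T, HasDerivAt α (f' (α t)) t := fun t ht =>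
    (hα t (Ioo_subset_Icc_self ht)).hasDerivAt (Icc_mem_nhds ht.1 ht.2)
  have hff' : ∀ y, ‖y‖ ≤ M + 1 → f' y = f y := fun y hy => by
    have : χ y = 1 := χ.one_of_mem_closedBall (by simpa [χ] using hy)
    simp [f', this]
  simp only at hα0
  refine ⟨α, hα0, ?_⟩
  -- Take the least t₁ at which α(t₁) or α(-t₁) has norm at least M + 1. On (-t₁, t₁) the original
  -- equation holds, so the a priori bound gives norm at most M there, and at ±t₁ by continuity.
  have key : ∀ t ∈ Ioo (-T) T, ‖α t‖ ≤ M + 1 := by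
    by_contra! hcon
    obtain ⟨τ, hτ, hτM⟩ := hcon
    have habs : |τ| < T := abs_lt.2 hτ
    have hcont : ContinuousOn α (Ioo (-T) T) := fun t ht => (hα' t ht).continuousAt.continuousWithinAt
    let S : Set ℝ := Icc 0 |τ| ∩ {t | M + 1 ≤ max ‖α t‖ ‖α (-t)‖}
    have hS : IsCompact S := by
      refine isCompact_Icc.of_isClosed_subset ?_ inter_subset_left
      refine ContinuousOn.preimage_isClosed_of_isClosed (t := Ici (M + 1))
        (f := fun t => max ‖α t‖ ‖α (-t)‖) ?_ isClosed_Icc isClosed_Ici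
      refine ContinuousOn.sup ?_ ?_
      · exact (hcont.mono fun t ht => ⟨by linarith [ht.1], by linarith [ht.2]⟩).norm
      · exact (hcont.comp (continuousOn_neg) fun t ht =>
          ⟨by linarith [ht.2], by linarith [ht.1]⟩).norm
    have hSne : S.Nonempty := by
      refine ⟨|τ|, ⟨abs_nonneg _, le_rfl⟩, ?_⟩
      rcases abs_cases τ with ⟨h, _⟩ | ⟨h, _⟩
      · simp only [mem_ofPred_eq, h]; exact hτM.le.trans (le_max_left _ _)
      · simp only [mem_ofPred_eq, h, neg_neg]; exact hτM.le.trans (le_max_right _ _)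
    obtain ⟨t₁, ⟨ht₁, ht₁M⟩, hmin⟩ := hS.exists_isLeast hSne
    have hsol : ∀ t ∈ Ioo (-t₁) t₁, HasDerivAt α (f (α t)) t := by
      intro t ht
      have htT : t ∈ Ioo (-T) T := ⟨by linarith [ht.1, ht₁.2], by linarith [ht.2, ht₁.2]⟩
      rw [← hff' (α t)]
      · exact hα' t htT
      by_contra! hlt
      have habt : |t| < t₁ := abs_lt.2 ht
      have : |t| ∈ S := by
        refine ⟨⟨abs_nonneg _, habt.le.trans ht₁.2⟩, ?_⟩
        rcases abs_cases t with ⟨h, _⟩ | ⟨h, _⟩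
        · simp only [mem_ofPred_eq, h]; exact hlt.le.trans (le_max_left _ _)
        · simp only [mem_ofPred_eq, h, neg_neg]; exact hlt.le.trans (le_max_right _ _)
      exact absurd (hmin this) (not_le.2 habt)
    have hbd := hM₀ t₁ (ht₁.2.trans habs.le) α hsol (by rw [hα0])
    have ht₁pos : 0 < t₁ := by
      rcases ht₁.1.lt_or_eq with h | h
      · exact h
      · exfalso
        have h1 : M + 1 ≤ max ‖α t₁‖ ‖α (-t₁)‖ := ht₁M
        rw [← h, neg_zero, max_self, hα0] at h1
        linarith
    have hT1 : t₁ < T := ht₁.2.trans_lt habs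
    have e1 : ‖α t₁‖ ≤ M := by
      refine le_of_tendsto (x := 𝓝[<] t₁)
        ((hα' t₁ ⟨by linarith, hT1⟩).continuousAt.norm.tendsto.mono_left nhdsWithin_le_nhds) ?_
      filter_upwards [Ioo_mem_nhdsLT (show -t₁ < t₁ by linarith)] with t ht
      exact (hbd t ht).trans (le_max_left _ _)
    have e2 : ‖α (-t₁)‖ ≤ M := by
      refine le_of_tendsto (x := 𝓝[>] (-t₁))
        ((hα' (-t₁) ⟨by linarith, by linarith⟩).continuousAt.norm.tendsto.mono_left
          nhdsWithin_le_nhds) ?_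
      filter_upwards [Ioo_mem_nhdsGT (show -t₁ < t₁ by linarith)] with t ht
      exact (hbd t ht).trans (le_max_left _ _)
    have h1 : M + 1 ≤ max ‖α t₁‖ ‖α (-t₁)‖ := ht₁M
    have := max_le e1 e2
    linarith
  intro t ht
  rw [← hff' _ (key t ht)]
  exact hα' t ht

/-- The value at time t is read off a solution on (-|t| - 1, |t| + 1); by uniqueness, the solutions
chosen for nearby times agree. -/
theorem NoBlowUp.exists_isFlow {f : E → E} (hb : NoBlowUp f) (hf : ContDiff ℝ 1 f) :
    ∃ F, IsFlow f F := by
  choose α hα0 hα using fun (x : E) (t : ℝ) =>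
    hb.exists_integralCurve_Ioo hf x (|t| + 1) (by positivity)
  refine ⟨fun t x => α x t t, fun x => hα0 x 0, fun x t => ?_⟩
  have ht : t ∈ Ioo (-(|t| + 1)) (|t| + 1) := abs_lt.1 (by linarith)
  refine (hα x t t ht).congr_of_eventuallyEq ?_
  filter_upwards [isOpen_Ioo.mem_nhds ht] with s hs
  have hs' : |s| < |t| + 1 := abs_lt.2 hs
  have hs'' : |s| < |s| + 1 := by linarith
  have hlt : |s| < min (|s| + 1) (|t| + 1) := lt_min hs'' hs'
  refine integralCurve_eqOn_Ioo hf (a := -min (|s| + 1) (|t| + 1)) (b := min (|s| + 1) (|t| + 1))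
    (t₀ := 0) ⟨?_, ?_⟩ (fun τ hτ => hα x s τ ?_) (fun τ hτ => hα x t τ ?_)
    (by rw [hα0, hα0]) (abs_lt.1 hlt)
  · linarith [abs_nonneg s]
  · linarith [abs_nonneg s]
  · exact abs_lt.1 ((abs_lt.2 hτ).trans_le (min_le_left _ _))
  · exact abs_lt.1 ((abs_lt.2 hτ).trans_le (min_le_right _ _))

variable {f : E → E} {F : ℝ → E → E}

theorem IsFlow.eq_of_integralCurve (hF : IsFlow f F) (hf : ContDiff ℝ 1 f) {α : ℝ → E}
    (hα : ∀ t, HasDerivAt α (f (α t)) t) (t : ℝ) : α t = F t (α 0) :=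
  integralCurve_eq hf (α' := fun t => F t (α 0)) (t₀ := 0) hα (hF.deriv _) (hF.zero _).symm t

theorem IsFlow.exists_norm_le (hF : IsFlow f F) (hb : NoBlowUp f) (T ρ : ℝ) :
    ∃ M, ∀ x, ‖x‖ ≤ ρ → ∀ t ∈ Ioo (-T) T, ‖F t x‖ ≤ M := by
  obtain ⟨M, hM⟩ := hb T ρ
  exact ⟨M, fun x hx => hM T le_rfl (fun t => F t x) (fun t _ => hF.deriv x t)
    (by rwa [hF.zero])⟩

theorem IsFlow.exists_norm_sub_le (hF : IsFlow f F) (hb : NoBlowUp f) (hf : ContDiff ℝ 1 f)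
    (T ρ : ℝ) : ∃ C, 0 ≤ C ∧ ∀ x x', ‖x‖ ≤ ρ → ‖x'‖ ≤ ρ → ∀ t ∈ Ioo (-T) T,
      ‖F t x - F t x'‖ ≤ C * ‖x - x'‖ := by
  obtain ⟨M, hM⟩ := hF.exists_norm_le hb T ρ
  obtain ⟨K, hK⟩ := exists_lipschitzOnWith_closedBall hf M
  refine ⟨Real.exp (K * T), (Real.exp_pos _).le, fun x x' hx hx' t ht => ?_⟩
  have := norm_le_gronwallBound_abs (u := fun t => F t x - F t x') (T := T) (K := K) (ε := 0)
    (u' := fun t => f (F t x) - f (F t x')) (fun t _ => (hF.deriv x t).sub (hF.deriv x' t))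
    (fun t ht => by
      simpa using hK.norm_sub_le (by simpa using hM x hx t ht) (by simpa using hM x' hx' t ht)) t ht
  rw [hF.zero, hF.zero, gronwallBound_ε0] at this
  refine this.trans ?_
  rw [mul_comm]
  gcongr
  exact (abs_lt.2 ht).le

theorem IsFlow.continuous (hF : IsFlow f F) (hb : NoBlowUp f) (hf : ContDiff ℝ 1 f) :
    Continuous (fun p : ℝ × E => F p.1 p.2) := by
  rw [continuous_iff_continuousAt]
  rintro ⟨t₀, x₀⟩
  obtain ⟨C, hC0, hC⟩ := hF.exists_norm_sub_le hb hf (|t₀| + 1) (‖x₀‖ + 1)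
  have hx : ContinuousOn (fun p : ℝ × E => F p.1 p.2)
      (Ioo (-(|t₀| + 1)) (|t₀| + 1) ×ˢ closedBall 0 (‖x₀‖ + 1)) := by
    refine continuousOn_prod_of_continuousOn_lipschitzOnWith' _ C.toNNReal ?_ ?_
    · intro t ht
      refine LipschitzOnWith.of_dist_le_mul fun x hx x' hx' => ?_
      rw [dist_eq_norm, dist_eq_norm, Real.coe_toNNReal C hC0]
      exact hC x x' (by simpa using hx) (by simpa using hx') t ht
    · intro x _
      exact fun t _ => (hF.deriv x t).continuousAt.continuousWithinAt
  refine hx.continuousAt (prod_mem_nhds ?_ ?_)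
  · exact isOpen_Ioo.mem_nhds (abs_lt.1 (by linarith))
  · exact closedBall_mem_nhds_of_mem (by simp)

/-- The prolongation of a vector field to the tangent bundle: its linearization along itself. -/
def tangentField (f : E → E) (p : E × E) : E × E := (f p.1, fderiv ℝ f p.1 p.2)

theorem contDiff_tangentField (hf : ContDiff ℝ 2 f) : ContDiff ℝ 1 (tangentField f) := by
  have h1 : ContDiff ℝ 1 (fderiv ℝ f) := hf.fderiv_right (by norm_num)
  exact ((hf.of_le (by norm_num)).comp contDiff_fst).prodMk
    ((h1.comp contDiff_fst).clm_apply contDiff_snd)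

/-- The second component solves a linear equation whose coefficients are bounded along the first, so
Grönwall controls it. -/
theorem NoBlowUp.tangentField (hb : NoBlowUp f) (hf : ContDiff ℝ 1 f) :
    NoBlowUp (tangentField f) := by
  intro T ρ
  obtain ⟨M, hM⟩ := hb T ρ
  obtain ⟨L, hL0, hL⟩ := exists_norm_fderiv_le_closedBall hf M
  refine ⟨max M (|ρ| * Real.exp (L * T)), fun T' hT' α hα h0 t ht => ?_⟩
  have hα1 : ∀ t ∈ Ioo (-T') T', HasDerivAt (fun t => (α t).1) (f (α t).1) t := fun t ht =>
    (hα t ht).fst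
  have hα2 : ∀ t ∈ Ioo (-T') T',
      HasDerivAt (fun t => (α t).2) (fderiv ℝ f (α t).1 (α t).2) t := fun t ht => (hα t ht).snd
  have hM1 := hM T' hT' _ hα1 ((norm_fst_le _).trans h0)
  have hG := norm_le_gronwallBound_abs (K := L) (ε := 0) hα2 (fun t ht => by
    rw [add_zero]
    exact (ContinuousLinearMap.le_opNorm _ _).trans
      (by gcongr; exact hL _ (by simpa using hM1 t ht))) t ht
  rw [gronwallBound_ε0] at hG
  refine max_le_max (hM1 t ht) (hG.trans ?_)
  have : |t| ≤ T := (abs_lt.2 ht).le.trans hT'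
  gcongr
  exact (norm_snd_le _).trans (h0.trans (le_abs_self _))

/-- The flow of a `C²` vector field is differentiable with respect to time and initial data, and
its derivative in the initial data solves the linearized equation. -/
theorem IsFlow.exists_hasStrictFDerivAt (hF : IsFlow f F) (hb : NoBlowUp f) (hf : ContDiff ℝ 2 f) :
    ∃ D : ℝ → E → E →L[ℝ] E,
      (∀ x, D 0 x = ContinuousLinearMap.id ℝ E) ∧
      (∀ x w t, HasDerivAt (fun t => D t x w) (fderiv ℝ f (F t x) (D t x w)) t) ∧
      ∀ t x, HasStrictFDerivAt (fun p : ℝ × E => F p.1 p.2)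
        ((ContinuousLinearMap.toSpanSingleton ℝ (f (F t x))).coprod (D t x)) (t, x) := by
  have := FiniteDimensional.proper ℝ E
  have hf1 : ContDiff ℝ 1 f := hf.of_le (by norm_num)
  have hb1 := hb.tangentField hf1
  have hf' := contDiff_tangentField hf
  obtain ⟨F', hF'⟩ := hb1.exists_isFlow hf'
  have hfst : ∀ t x w, (F' t (x, w)).1 = F t x := fun t x w => by
    have := hF.eq_of_integralCurve hf1 (α := fun t => (F' t (x, w)).1)
      (fun t => (hF'.deriv (x, w) t).fst) t
    simpa [hF'.zero] using this
  have hsnd : ∀ x w t, HasDerivAt (fun t => (F' t (x, w)).2)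
      (fderiv ℝ f (F t x) (F' t (x, w)).2) t := fun x w t => by
    have h : HasDerivAt (fun t => (F' t (x, w)).2)
      (fderiv ℝ f (F' t (x, w)).1 (F' t (x, w)).2) t := (hF'.deriv (x, w) t).snd
    rwa [hfst] at h
  have huniq : ∀ x w (α : ℝ → E), (∀ t, HasDerivAt α (fderiv ℝ f (F t x) (α t)) t) → α 0 = w →
      ∀ t, α t = (F' t (x, w)).2 := fun x w α hα h0 t => by
    have := hF'.eq_of_integralCurve hf' (α := fun t => (F t x, α t))
      (fun t => (hF.deriv x t).prodMk (hα t)) t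
    simpa [hF.zero, h0] using congrArg Prod.snd this
  -- The candidate derivative is the fibre component of the prolonged flow; uniqueness for the
  -- linearized equation makes it linear in `w`.
  let D : ℝ → E → E →L[ℝ] E := fun t x => LinearMap.toContinuousLinearMap
    { toFun := fun w => (F' t (x, w)).2
      map_add' := fun w w' => (huniq x (w + w') (fun t => (F' t (x, w)).2 + (F' t (x, w')).2)
        (fun t => by simpa using (hsnd x w t).fun_add (hsnd x w' t)) (by simp [hF'.zero]) t).symm
      map_smul' := fun a w => (huniq x (a • w) (fun t => a • (F' t (x, w)).2)
        (fun t => by simpa using (hsnd x w t).fun_const_smul a) (by simp [hF'.zero]) t).symm }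
  have hD : ∀ t x w, D t x w = (F' t (x, w)).2 := fun _ _ _ => rfl
  have hD0 : ∀ x, D 0 x = ContinuousLinearMap.id ℝ E := fun x => by
    ext w; simp [hD, hF'.zero]
  have hDd : ∀ x w t, HasDerivAt (fun t => D t x w) (fderiv ℝ f (F t x) (D t x w)) t := hsnd
  have hDc : Continuous (fun p : ℝ × E => D p.1 p.2) := by
    rw [continuous_clm_apply]
    intro w
    exact ((hF'.continuous hb1 hf').comp
      (continuous_fst.prodMk (continuous_snd.prodMk continuous_const))).snd
  have hspace : ∀ t x, HasFDerivAt (F t) (D t x) x := by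
    intro t x
    obtain ⟨M, hM⟩ := hF.exists_norm_le hb (|t| + 1) (‖x‖ + 1)
    obtain ⟨L, hL0, hL⟩ := exists_norm_fderiv_le_closedBall hf1 M
    obtain ⟨L₂, hL₂⟩ := exists_lipschitzOnWith_closedBall
      (hf.fderiv_right (m := 1) (by norm_num)) M
    obtain ⟨C, hC0, hC⟩ := hF.exists_norm_sub_le hb hf1 (|t| + 1) (‖x‖ + 1)
    have hquad : ∀ a ∈ closedBall (0 : E) M, ∀ b ∈ closedBall (0 : E) M,
        ‖f a - f b - fderiv ℝ f b (a - b)‖ ≤ L₂ * ‖a - b‖ * ‖a - b‖ := by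
      intro a ha b hb'
      refine Convex.norm_image_sub_le_of_norm_fderiv_le' (s := segment ℝ b a)
        (fun z _ => hf1.differentiable one_ne_zero z) ?_ (convex_segment b a)
        (left_mem_segment ℝ b a) (right_mem_segment ℝ b a)
      intro z hz
      refine (hL₂.norm_sub_le ((convex_closedBall 0 M).segment_subset hb' ha hz) hb').trans ?_
      gcongr
      obtain ⟨θ, hθ, rfl⟩ := (segment_eq_image' ℝ b a ▸ hz)
      rw [add_sub_cancel_left, norm_smul, Real.norm_of_nonneg hθ.1]
      exact mul_le_of_le_one_left (norm_nonneg _) hθ.2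
    have ht : t ∈ Ioo (-(|t| + 1)) (|t| + 1) := abs_lt.1 (by linarith)
    -- The linearization error starts at 0 and satisfies the linearized equation up to a Taylor
    -- remainder of size O(‖h‖²); Grönwall keeps it of that size.
    have hest : ∀ h : E, ‖h‖ ≤ 1 → ‖F t (x + h) - F t x - D t x h‖ ≤
        (L₂ * C ^ 2 * ((Real.exp (L * |t|) - 1) / L)) * ‖h‖ ^ 2 := by
      intro h hh
      have hxh : ‖x + h‖ ≤ ‖x‖ + 1 := (norm_add_le _ _).trans (by linarith)
      have hx1 : ‖x‖ ≤ ‖x‖ + 1 := by linarith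
      have := norm_le_gronwallBound_abs (T := |t| + 1) (K := L) (ε := L₂ * (C * ‖h‖) ^ 2)
        (u := fun t => F t (x + h) - F t x - D t x h)
        (u' := fun t => f (F t (x + h)) - f (F t x) - fderiv ℝ f (F t x) (D t x h))
        (fun t _ => ((hF.deriv _ t).sub (hF.deriv _ t)).sub (hDd x h t)) (fun s hs => by
          have h1 : F s (x + h) ∈ closedBall (0 : E) M := by simpa using hM _ hxh s hs
          have h2 : F s x ∈ closedBall (0 : E) M := by simpa using hM _ hx1 s hs
          have h3 := hquad _ h1 _ h2
          have h4 : ‖F s (x + h) - F s x‖ ≤ C * ‖h‖ := by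
            simpa using hC _ _ hxh hx1 s hs
          have h5 : f (F s (x + h)) - f (F s x) - fderiv ℝ f (F s x) (D s x h) =
              fderiv ℝ f (F s x) (F s (x + h) - F s x - D s x h) +
              (f (F s (x + h)) - f (F s x) - fderiv ℝ f (F s x) (F s (x + h) - F s x)) := by
            simp only [map_sub]; abel
          rw [h5]
          refine (norm_add_le _ _).trans (add_le_add ?_ (h3.trans ?_))
          · exact (ContinuousLinearMap.le_opNorm _ _).trans (by gcongr; exact hL _ h2)
          · rw [mul_assoc, sq]
            gcongr) t ht
      refine this.trans (le_of_eq ?_)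
      rw [gronwallBound_of_K_ne_0 hL0.ne']
      simp only [hF.zero, hD0, ContinuousLinearMap.id_apply, add_sub_cancel_left, sub_self,
        norm_zero, zero_mul, zero_add]
      ring
    rw [hasFDerivAt_iff_isLittleO_nhds_zero]
    refine Asymptotics.IsBigO.trans_isLittleO (g := fun h : E => ‖h‖ ^ 2) ?_ ?_
    · refine Asymptotics.IsBigO.of_bound (L₂ * C ^ 2 * ((Real.exp (L * |t|) - 1) / L)) ?_
      filter_upwards [closedBall_mem_nhds (0 : E) one_pos] with h hh
      simpa using hest h (by simpa using hh)
    · exact (Asymptotics.isLittleO_norm_pow_id one_lt_two)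
  refine ⟨D, hD0, hDd, fun t x => ?_⟩
  have hfc : Continuous (fun p : ℝ × E => f (F p.1 p.2)) :=
    hf.continuous.comp (hF.continuous hb hf1)
  exact hasStrictFDerivAt_uncurry_coprod (u := (t, x)) (f := F)
    (f₁ := fun t x => ContinuousLinearMap.toSpanSingleton ℝ (f (F t x))) (f₂ := D)
    (Eventually.of_forall fun v => (hF.deriv v.2 v.1).hasFDerivAt)
    (Eventually.of_forall fun v => hspace v.1 v.2)
    (by
      have : Continuous fun p : ℝ × E => ContinuousLinearMap.toSpanSingleton ℝ (f (F p.1 p.2)) := by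
        rw [continuous_clm_apply]
        intro a
        simpa using hfc.fun_const_smul a
      exact this.continuousAt) hDc.continuousAt

end ODE

end CuspFunnel

end

/-! ### The Levi-Civita connection and the geodesic vector field in one chart -/

noncomputable section

set_option maxSynthPendingDepth 3

namespace CuspFunnel

/-- A smooth Riemannian metric on a finite-dimensional vector space `V`, regarded as a
manifold with one chart. -/
structure ChartMetric (V : Type*) [NormedAddCommGroup V] [NormedSpace ℝ V] where
  form : V → V →L[ℝ] V →L[ℝ] ℝ
  smooth : ContDiff ℝ ∞ form
  symm : ∀ x u v, form x u v = form x v u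
  pos : ∀ x u, u ≠ 0 → 0 < form x u u

namespace ChartMetric

variable {V : Type*} [NormedAddCommGroup V] [NormedSpace ℝ V] (g : ChartMetric V)

theorem self_nonneg (x u : V) : 0 ≤ g.form x u u := by
  rcases eq_or_ne u 0 with rfl | hu
  · simp
  · exact (g.pos x u hu).le

theorem self_eq_zero {x u : V} (h : g.form x u u = 0) : u = 0 := by
  by_contra hu
  exact (g.pos x u hu).ne' h

theorem form_injective (x : V) : Function.Injective (g.form x) := by
  rw [injective_iff_map_eq_zero]
  intro u hu
  exact g.self_eq_zero (x := x) (by rw [hu]; rfl)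

theorem hasFDerivAt_form (x : V) : HasFDerivAt g.form (fderiv ℝ g.form x) x :=
  (g.smooth.differentiable (by simp) x).hasFDerivAt

theorem fderiv_form_symm (x w u v : V) :
    fderiv ℝ g.form x w u v = fderiv ℝ g.form x w v u := by
  have h : ∀ a b, fderiv ℝ (fun p => g.form p a b) x w = fderiv ℝ g.form x w a b := fun a b => by
    have h1 : HasFDerivAt (fun p => g.form p a b) _ x :=
      ((g.hasFDerivAt_form x).clm_apply (hasFDerivAt_const a x)).clm_apply (hasFDerivAt_const b x)
    rw [h1.fderiv]
    simp
  rw [← h, ← h]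
  simp_rw [g.symm _ u v]

/-- The Christoffel symbols as a bilinear map. -/
def christoffel (x : V) : V →L[ℝ] V →L[ℝ] V :=
  (ContinuousLinearMap.compL ℝ V (V →L[ℝ] ℝ) V ((1 / 2 : ℝ) • (g.form x).inverse)).comp
    (fderiv ℝ g.form x + (fderiv ℝ g.form x).flip -
      ((ContinuousLinearMap.flipₗᵢ ℝ V V ℝ).toContinuousLinearEquiv :
        (V →L[ℝ] V →L[ℝ] ℝ) →L[ℝ] V →L[ℝ] V →L[ℝ] ℝ).comp (fderiv ℝ g.form x).flip)

theorem christoffel_apply (x u v : V) :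
    g.christoffel x u v = (1 / 2 : ℝ) • (g.form x).inverse
      (fderiv ℝ g.form x u v + fderiv ℝ g.form x v u - ((fderiv ℝ g.form x).flip u).flip v) := rfl

/-- The Riemann curvature tensor `R(u, v) w`. -/
def curvature (x u v w : V) : V :=
  fderiv ℝ g.christoffel x u v w - fderiv ℝ g.christoffel x v u w
    + g.christoffel x u (g.christoffel x v w) - g.christoffel x v (g.christoffel x u w)

/-- The geodesic equation as a vector field on the tangent bundle. -/
def geodesicField (p : V × V) : V × V := (p.2, -g.christoffel p.1 p.2 p.2)

variable [FiniteDimensional ℝ V]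

/-- The lowering of indices `v ↦ g(v, ·)` as an equivalence. -/
def flat (x : V) : V ≃L[ℝ] (V →L[ℝ] ℝ) :=
  LinearEquiv.toContinuousLinearEquiv
    (LinearMap.linearEquivOfInjective (g.form x : V →ₗ[ℝ] (V →L[ℝ] ℝ)) (g.form_injective x)
      (by
        rw [← (LinearMap.toContinuousLinearMap (𝕜 := ℝ) (E := V) (F' := ℝ)).finrank_eq]
        exact (Subspace.dual_finrank_eq (K := ℝ) (V := V)).symm))

theorem coe_flat (x : V) : (g.flat x : V →L[ℝ] V →L[ℝ] ℝ) = g.form x := rfl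

theorem form_inverse_apply (x : V) (l : V →L[ℝ] ℝ) : g.form x ((g.form x).inverse l) = l := by
  have h : (g.form x).inverse = ((g.flat x).symm : (V →L[ℝ] ℝ) →L[ℝ] V) := by
    rw [← coe_flat, ContinuousLinearMap.inverse_equiv]
  rw [h]
  exact (g.flat x).apply_symm_apply l

theorem contDiff_inverse_form : ContDiff ℝ ∞ fun x => (g.form x).inverse := by
  have := FiniteDimensional.complete ℝ V
  rw [contDiff_iff_contDiffAt]
  intro x
  have h : ContDiffAt ℝ ∞ ContinuousLinearMap.inverse (g.form x) := by
    rw [← coe_flat]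
    exact contDiffAt_map_inverse (g.flat x)
  exact h.comp x g.smooth.contDiffAt

/-- Koszul's formula, from which symmetry and metric compatibility of the connection follow. -/
theorem form_christoffel (x u v z : V) :
    2 * g.form x (g.christoffel x u v) z =
      fderiv ℝ g.form x u v z + fderiv ℝ g.form x v u z - fderiv ℝ g.form x z u v := by
  simp only [christoffel_apply, map_smul, form_inverse_apply]
  simp

theorem christoffel_symm (x u v : V) : g.christoffel x u v = g.christoffel x v u := by
  apply g.form_injective x
  refine ContinuousLinearMap.ext fun z => ?_
  have h1 := g.form_christoffel x u v z
  have h2 := g.form_christoffel x v u z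
  rw [g.fderiv_form_symm x z u v] at h1
  linarith

/-- The Levi-Civita connection is compatible with the metric. -/
theorem fderiv_form_eq (x w u v : V) :
    fderiv ℝ g.form x w u v =
      g.form x (g.christoffel x w u) v + g.form x u (g.christoffel x w v) := by
  have h1 := g.form_christoffel x w u v
  have h2 := g.form_christoffel x w v u
  rw [g.symm x u]
  have := g.fderiv_form_symm x u w v
  have := g.fderiv_form_symm x v w u
  have := g.fderiv_form_symm x w u v
  linarith

theorem contDiff_christoffel : ContDiff ℝ ∞ g.christoffel := by
  have h1 : ContDiff ℝ ∞ (fderiv ℝ g.form) := g.smooth.fderiv_right (by simp)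
  have h3 : ContDiff ℝ ∞ fun x => (fderiv ℝ g.form x).flip :=
    (ContinuousLinearMap.flipₗᵢ ℝ V V (V →L[ℝ] ℝ)).toContinuousLinearEquiv.contDiff.comp h1
  unfold christoffel
  refine ContDiff.clm_comp ?_ ?_
  · exact (ContinuousLinearMap.compL ℝ V (V →L[ℝ] ℝ) V).contDiff.comp
      (g.contDiff_inverse_form.const_smul (1 / 2 : ℝ))
  · exact (h1.add h3).sub (contDiff_const.clm_comp h3)

theorem hasFDerivAt_christoffel (x : V) :
    HasFDerivAt g.christoffel (fderiv ℝ g.christoffel x) x :=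
  (g.contDiff_christoffel.differentiable (by simp) x).hasFDerivAt

theorem fderiv_christoffel_apply (x w u v : V) :
    fderiv ℝ (fun p => g.christoffel p u v) x w = fderiv ℝ g.christoffel x w u v := by
  have h1 : HasFDerivAt (fun p => g.christoffel p u v) _ x :=
    ((g.hasFDerivAt_christoffel x).clm_apply (hasFDerivAt_const u x)).clm_apply
      (hasFDerivAt_const v x)
  rw [h1.fderiv]
  simp

theorem fderiv_christoffel_symm (x w u v : V) :
    fderiv ℝ g.christoffel x w u v = fderiv ℝ g.christoffel x w v u := by
  rw [← fderiv_christoffel_apply, ← fderiv_christoffel_apply]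
  simp_rw [g.christoffel_symm _ u v]

/-- The derivative of an inner product along a curve, in terms of covariant derivatives. -/
theorem hasDerivAt_form_along {x a b : ℝ → V} {x' a' b' : V} {t : ℝ}
    (hx : HasDerivAt x x' t) (ha : HasDerivAt a a' t) (hb : HasDerivAt b b' t) :
    HasDerivAt (fun t => g.form (x t) (a t) (b t))
      (g.form (x t) (a' + g.christoffel (x t) x' (a t)) (b t) +
        g.form (x t) (a t) (b' + g.christoffel (x t) x' (b t))) t := by
  have h1 : HasDerivAt (fun t => g.form (x t)) (fderiv ℝ g.form (x t) x') t :=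
    (g.hasFDerivAt_form (x t)).comp_hasDerivAt t hx
  refine ((h1.clm_apply ha).clm_apply hb).congr_deriv ?_
  simp only [map_add, add_apply, fderiv_form_eq]
  ring

theorem contDiff_geodesicField : ContDiff ℝ ∞ g.geodesicField := by
  have := g.contDiff_christoffel
  unfold geodesicField
  fun_prop

/-- The linearized geodesic flow is the Jacobi equation in coordinates; the factor 2 comes from the
symmetry of Γ. -/
theorem fderiv_geodesicField (p w : V × V) :
    fderiv ℝ g.geodesicField p w =
      (w.2, -(fderiv ℝ g.christoffel p.1 w.1 p.2 p.2 + (2 : ℝ) • g.christoffel p.1 p.2 w.2)) := by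
  have h1 : HasFDerivAt (fun q : V × V => g.christoffel q.1) _ p :=
    (g.hasFDerivAt_christoffel p.1).comp p hasFDerivAt_fst
  have h2 : HasFDerivAt (𝕜 := ℝ) (fun q : V × V => q.2) _ p := hasFDerivAt_snd
  have h3 : HasFDerivAt g.geodesicField _ p := h2.prodMk ((h1.clm_apply h2).clm_apply h2).neg
  rw [h3.fderiv]
  simp only [ContinuousLinearMap.prod_apply, ContinuousLinearMap.coe_snd',
    neg_apply, add_apply, ContinuousLinearMap.comp_apply,
    ContinuousLinearMap.flip_apply, ContinuousLinearMap.coe_fst']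
  rw [g.christoffel_symm p.1 w.2 p.2]
  congr 2
  module

end ChartMetric

variable {n : ℕ} {c : Fin n → EuclideanSpace ℝ (Fin n)}

/-- The lift of a metric on the cylinder to the universal cover. -/
def Metric.chart (g : Metric c) : ChartMetric (Cover n) where
  form := g.lift
  smooth := g.smooth
  symm _ := g.symm _
  pos _ := g.pos _

theorem Metric.christoffel_eq (g : Metric c) (x u v : Cover n) :
    g.christoffel x u v = g.chart.christoffel x u v := rfl

theorem Metric.curvature_eq (g : Metric c) (x u v w : Cover n) :
    g.curvature x u v w = g.chart.curvature x u v w := by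
  simp only [curvature, Metric.christoffel_eq, ChartMetric.fderiv_christoffel_apply]
  rfl

end CuspFunnel

end

/-! ### Conservation of speed and the Jacobi equation -/

noncomputable section

set_option maxSynthPendingDepth 3

namespace CuspFunnel

open Set

namespace ChartMetric

variable {V : Type*} [NormedAddCommGroup V] [NormedSpace ℝ V] [FiniteDimensional ℝ V]
  (g : ChartMetric V)

/-- Geodesics have constant speed. -/
theorem speed_eq {α : ℝ → V × V} {T : ℝ}
    (hα : ∀ t ∈ Ioo (-T) T, HasDerivAt α (g.geodesicField (α t)) t) {t : ℝ} (ht : t ∈ Ioo (-T) T) :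
    g.form (α t).1 (α t).2 (α t).2 = g.form (α 0).1 (α 0).2 (α 0).2 := by
  have hd : ∀ t ∈ Ioo (-T) T, HasDerivAt
      (fun t => g.form (α t).1 (α t).2 (α t).2 - g.form (α 0).1 (α 0).2 (α 0).2) 0 t := by
    intro t ht
    have hx : HasDerivAt (fun t => (α t).1) (α t).2 t := (hα t ht).fst
    have hv : HasDerivAt (fun t => (α t).2) (-g.christoffel (α t).1 (α t).2 (α t).2) t :=
      (hα t ht).snd
    simpa using (g.hasDerivAt_form_along hx hv hv).sub_const
      (g.form (α 0).1 (α 0).2 (α 0).2)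
  have := norm_le_gronwallBound_abs (K := 0) (ε := 0) hd (by simp) t ht
  rw [gronwallBound_K0] at this
  simpa [sub_eq_zero] using this

section Jacobi

variable {x v J W : ℝ → V} {t : ℝ} (hx : HasDerivAt x (v t) t)
  (hv : HasDerivAt v (-g.christoffel (x t) (v t) (v t)) t) (hJ : HasDerivAt J (W t) t)
  (hW : HasDerivAt W (-(fderiv ℝ g.christoffel (x t) (J t) (v t) (v t)
    + (2 : ℝ) • g.christoffel (x t) (v t) (W t))) t)

include hx hv hJ hW in
/-- The Jacobi equation `D²J = -R(J, v) v`, where `DJ = J' + Γ(v, J)`. -/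
theorem hasDerivAt_covariantDeriv :
    HasDerivAt (fun t => W t + g.christoffel (x t) (v t) (J t))
      (-g.curvature (x t) (J t) (v t) (v t)
        - g.christoffel (x t) (v t) (W t + g.christoffel (x t) (v t) (J t))) t := by
  have h1 : HasDerivAt (fun t => g.christoffel (x t)) (fderiv ℝ g.christoffel (x t) (v t)) t :=
    (g.hasFDerivAt_christoffel (x t)).comp_hasDerivAt t hx
  refine (hW.add ((h1.clm_apply hv).clm_apply hJ)).congr_deriv ?_
  simp only [curvature, map_add, add_apply, map_neg, neg_apply]
  rw [g.fderiv_christoffel_symm (x t) (v t) (J t) (v t),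
    g.christoffel_symm (x t) (g.christoffel (x t) (v t) (v t)) (J t),
    g.christoffel_symm (x t) (J t) (v t)]
  module

include hx hJ in
theorem hasDerivAt_jacobi_norm_sq :
    HasDerivAt (fun t => g.form (x t) (J t) (J t))
      (2 * g.form (x t) (W t + g.christoffel (x t) (v t) (J t)) (J t)) t := by
  refine (g.hasDerivAt_form_along hx hJ hJ).congr_deriv ?_
  rw [g.symm _ (J t)]
  ring

include hx hv hJ hW in
theorem hasDerivAt_jacobi_inner :
    HasDerivAt (fun t => g.form (x t) (W t + g.christoffel (x t) (v t) (J t)) (J t))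
      (g.form (x t) (W t + g.christoffel (x t) (v t) (J t))
          (W t + g.christoffel (x t) (v t) (J t))
        - g.form (x t) (g.curvature (x t) (J t) (v t) (v t)) (J t)) t := by
  refine (g.hasDerivAt_form_along hx (g.hasDerivAt_covariantDeriv hx hv hJ hW) hJ).congr_deriv ?_
  rw [sub_add_cancel]
  simp only [map_neg, neg_apply]
  ring

end Jacobi

end ChartMetric

/-! ### Compactness of the torus and absence of blow-up for geodesics -/

section Lattice

variable {n : ℕ} {c : Fin n → EuclideanSpace ℝ (Fin n)}

/-- The torus is the image of a compact subset of `ℝⁿ`. -/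
theorem exists_compact_representatives (hc : LinearIndependent ℝ c) :
    ∃ K : Set (EuclideanSpace ℝ (Fin n)), IsCompact K ∧ ∀ y, ∃ l ∈ lattice c, y - l ∈ K := by
  let b : Module.Basis (Fin n) ℝ (EuclideanSpace ℝ (Fin n)) :=
    Module.Basis.mk hc (hc.span_eq_top_of_card_eq_finrank' (by simp)).ge
  have hb : ⇑b = c := Module.Basis.coe_mk _ _
  refine ⟨closure (ZSpan.fundamentalDomain b),
    (ZSpan.fundamentalDomain_isBounded b).isCompact_closure, fun y =>
      ⟨ZSpan.floor b y, ?_, subset_closure (ZSpan.fract_mem_fundamentalDomain b y)⟩⟩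
  rw [lattice, ← hb, ← Submodule.span_int_eq_addSubgroupClosure]
  exact (ZSpan.floor b y).2

theorem proj_sub_lattice (x : Cover n) {l : EuclideanSpace ℝ (Fin n)} (hl : l ∈ lattice c) :
    proj c (x.1, x.2 - l) = proj c x := by
  unfold proj
  congr 1
  rw [QuotientAddGroup.eq]
  simpa using hl

/-- A continuous function on the cover that is invariant under the lattice is bounded on
`{|r| ≤ A}`. -/
theorem exists_bound_of_periodic (hc : LinearIndependent ℝ c) {f : Cover n → ℝ}
    (hf : Continuous f) (hper : ∀ x : Cover n, ∀ l ∈ lattice c, f (x.1, x.2 - l) = f x) (A : ℝ) :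
    ∃ M, ∀ x : Cover n, |x.1| ≤ A → |f x| ≤ M := by
  obtain ⟨K, hK, hrep⟩ := exists_compact_representatives hc
  obtain ⟨M, hM⟩ := (isCompact_Icc (a := -A) (b := A)).prod hK |>.exists_bound_of_continuousOn
    hf.continuousOn
  refine ⟨M, fun x hx => ?_⟩
  obtain ⟨l, hl, hlK⟩ := hrep x.2
  rw [← hper x l hl]
  exact hM _ ⟨abs_le.1 hx, hlK⟩

namespace Metric

variable (g : Metric c)

theorem lift_sub_lattice (x : Cover n) {l : EuclideanSpace ℝ (Fin n)} (hl : l ∈ lattice c) :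
    g.lift (x.1, x.2 - l) = g.lift x := by
  simp only [lift, proj_sub_lattice x hl]

/-- By homogeneity and lattice invariance it is enough to minimize over unit vectors at base points
in a compact set. -/
theorem exists_lower_bound (hc : LinearIndependent ℝ c) (A : ℝ) :
    ∃ m, 0 < m ∧ ∀ x : Cover n, |x.1| ≤ A → ∀ v : Cover n, m * ‖v‖ ^ 2 ≤ g.lift x v v := by
  obtain ⟨K, hK, hrep⟩ := exists_compact_representatives hc
  have hcpt : IsCompact ((Icc (-A) A ×ˢ K) ×ˢ Metric.sphere (0 : Cover n) 1) :=
    (isCompact_Icc.prod hK).prod (isCompact_sphere 0 1)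
  have hcont : Continuous fun p : Cover n × Cover n => g.lift p.1 p.2 p.2 :=
    ((g.chart.smooth.continuous.comp continuous_fst).clm_apply continuous_snd).clm_apply
      continuous_snd
  obtain ⟨m, hm, hle⟩ := hcpt.exists_forall_le' hcont.continuousOn (a := 0) fun p hp => by
    refine g.chart.pos _ _ fun h => ?_
    have := hp.2
    rw [h] at this
    simp at this
  refine ⟨m, hm, fun x hx v => ?_⟩
  rcases eq_or_ne v 0 with rfl | hv
  · simp
  obtain ⟨l, hl, hlK⟩ := hrep x.2
  have h := hle ((x.1, x.2 - l), ‖v‖⁻¹ • v) ⟨⟨abs_le.1 hx, hlK⟩, by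
    simp [norm_smul, norm_ne_zero_iff.2 hv]⟩
  simp only [g.lift_sub_lattice x hl, map_smul, smul_apply, smul_eq_mul] at h
  have hv' : 0 < ‖v‖ := norm_pos_iff.2 hv
  calc m * ‖v‖ ^ 2 ≤ (‖v‖⁻¹ * (‖v‖⁻¹ * g.lift x v v)) * ‖v‖ ^ 2 := by gcongr
    _ = g.lift x v v := by field_simp

/-- Geodesics do not blow up in finite time if `g` dominates a multiple of `dr²`. -/
theorem noBlowUp_geodesicField (hc : LinearIndependent ℝ c) {m : ℝ} (hm : 0 < m)
    (hr : ∀ x v : Cover n, m * v.1 ^ 2 ≤ g.lift x v v) : NoBlowUp g.chart.geodesicField := by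
  intro T ρ
  have hcont : Continuous fun p : Cover n × Cover n => g.lift p.1 p.2 p.2 :=
    ((g.chart.smooth.continuous.comp continuous_fst).clm_apply continuous_snd).clm_apply
      continuous_snd
  obtain ⟨e, he⟩ := (isCompact_closedBall (0 : Cover n × Cover n) ρ).exists_bound_of_continuousOn
    hcont.continuousOn
  -- The initial energy is at most `e`, so `C` bounds |r'| and confines r to a compact range. The
  -- lower bound `m'` over that range then turns energy into the bound `C'` on the whole velocity.
  set C := Real.sqrt (e / m)
  obtain ⟨m', hm', hlow⟩ := g.exists_lower_bound hc (|ρ| + C * |T|)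
  set C' := Real.sqrt (e / m')
  refine ⟨max (|ρ| + C' * |T|) C', fun T' hT' α hα h0 t ht => ?_⟩
  have hTT : ∀ t ∈ Ioo (-T') T', |t| ≤ |T| := fun t ht =>
    (abs_lt.2 ht).le.trans (hT'.trans (le_abs_self T))
  have hx : ∀ t ∈ Ioo (-T') T', HasDerivAt (fun t => (α t).1) (α t).2 t :=
    fun t ht => (hα t ht).fst
  have hE : ∀ t ∈ Ioo (-T') T', g.lift (α t).1 (α t).2 (α t).2 ≤ e := fun t ht => by
    have h1 : g.lift (α t).1 (α t).2 (α t).2 = g.lift (α 0).1 (α 0).2 (α 0).2 :=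
      g.chart.speed_eq hα ht
    rw [h1]
    exact (le_abs_self _).trans (he (α 0) (by simpa using h0))
  have hρ : ‖α 0‖ ≤ |ρ| := h0.trans (le_abs_self ρ)
  have hr' : ∀ t ∈ Ioo (-T') T', |(α t).1.1| ≤ |ρ| + C * |T| := by
    intro t ht
    have := norm_le_gronwallBound_abs (K := 0) (ε := C) (u := fun t => (α t).1.1)
      (fun t ht => (hx t ht).fst) (fun t ht => by
        rw [zero_mul, zero_add]
        refine Real.abs_le_sqrt ?_
        rw [le_div_iff₀ hm, mul_comm]
        exact (hr _ _).trans (hE t ht)) t ht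
    rw [gronwallBound_K0] at this
    refine this.trans (add_le_add ?_ (mul_le_mul_of_nonneg_left (hTT t ht) (Real.sqrt_nonneg _)))
    exact (norm_fst_le _).trans ((norm_fst_le _).trans hρ)
  have hv : ∀ t ∈ Ioo (-T') T', ‖(α t).2‖ ≤ C' := by
    intro t ht
    refine Real.le_sqrt_of_sq_le ?_
    rw [le_div_iff₀ hm', mul_comm]
    exact (hlow _ (hr' t ht) _).trans (hE t ht)
  refine max_le_max ?_ (hv t ht)
  have := norm_le_gronwallBound_abs (K := 0) (ε := C') hx
    (fun t ht => by rw [zero_mul, zero_add]; exact hv t ht) t ht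
  rw [gronwallBound_K0] at this
  exact this.trans (add_le_add ((norm_fst_le _).trans hρ)
    (mul_le_mul_of_nonneg_left (hTT t ht) (Real.sqrt_nonneg _)))

theorem isLiftedGeodesic_of_integralCurve {α : ℝ → Cover n × Cover n}
    (hα : ∀ t, HasDerivAt α (g.chart.geodesicField (α t)) t) :
    g.IsLiftedGeodesic fun t => (α t).1 :=
  ⟨fun t => (α t).2, fun t => (hα t).fst, fun t => (hα t).snd⟩

end Metric

end Lattice

end CuspFunnel

end

/-! ### Curvature of the warped ends -/

noncomputable section

set_option maxSynthPendingDepth 3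

namespace CuspFunnel

open Set

namespace ChartMetric

variable {V : Type*} [NormedAddCommGroup V] [NormedSpace ℝ V] (g : ChartMetric V)

/-- The Gram determinant is g(v, v) times the squared length of the component of u orthogonal to v.
-/
theorem gram_pos (x : V) {u v : V} (hv : v ≠ 0) (h : ∀ a : ℝ, a • v ≠ u) :
    0 < g.form x u u * g.form x v v - g.form x u v ^ 2 := by
  have hvv := g.pos x v hv
  have hw := g.pos x (u - (g.form x u v / g.form x v v) • v) fun h0 =>
    h _ (sub_eq_zero.1 h0).symm
  simp only [map_sub, map_smul, sub_apply, smul_apply, smul_eq_mul, g.symm x v u] at hw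
  have hE : g.form x u u - g.form x u v / g.form x v v * g.form x u v -
      g.form x u v / g.form x v v *
        (g.form x u v - g.form x u v / g.form x v v * g.form x v v) =
      (g.form x u u * g.form x v v - g.form x u v ^ 2) / g.form x v v := by
    field_simp
    ring
  have h2 : 0 < (g.form x u u * g.form x v v - g.form x u v ^ 2) / g.form x v v := by
    rw [← hE]
    convert hw using 1
  exact (div_pos_iff_of_pos_right hvv).1 h2

/-- Nonpositive sectional curvature in terms of the curvature tensor. -/
theorem curvature_nonpos_of_sectional (x : V)
    (h : ∀ u v : V, LinearIndependent ℝ ![u, v] →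
      g.form x (g.curvature x u v v) u /
        (g.form x u u * g.form x v v - g.form x u v ^ 2) ≤ 0) (u v : V) :
    g.form x (g.curvature x u v v) u ≤ 0 := by
  rcases eq_or_ne v 0 with rfl | hv
  · simp [curvature]
  by_cases hu : ∀ a : ℝ, a • v ≠ u
  · have hli : LinearIndependent ℝ ![u, v] := by
      rw [LinearIndependent.pair_symm_iff, LinearIndependent.pair_iff' hv]
      exact hu
    exact (div_le_iff₀ (g.gram_pos x hv hu)).1 (h u v hli) |>.trans (by simp)
  · push Not at hu
    obtain ⟨a, rfl⟩ := hu
    simp [curvature]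

end ChartMetric

namespace Metric

variable {n : ℕ} {c : Fin n → EuclideanSpace ℝ (Fin n)} {g : Metric c} {R : ℝ} {β : ℝ → ℝ}

/-- The squared warping factor `e^{2(r + β(r))}`. -/
def warp (β : ℝ → ℝ) (r : ℝ) : ℝ := Real.exp (2 * (r + β r))

theorem hasDerivAt_warp (hβ : ContDiff ℝ ∞ β) (r : ℝ) :
    HasDerivAt (warp β) (2 * (1 + deriv β r) * warp β r) r := by
  have h1 : HasDerivAt β (deriv β r) r := (hβ.differentiable (by simp) r).hasDerivAt
  refine (((hasDerivAt_id r).add h1).const_mul 2).exp.congr_deriv ?_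
  simp only [warp, id, Pi.add_apply]
  ring

variable (hw : ∀ p : Cylinder c, R < |p.1| → ∀ u v : Cover n,
  g.form p u v = warpedForm p.1 (β p.1) u v)

theorem eventually_lt_abs_fst {x : Cover n} (hx : R < |x.1|) : ∀ᶠ p in nhds x, R < |p.1| :=
  (isOpen_lt continuous_const continuous_fst.abs).mem_nhds hx

include hw in
theorem form_of_warped {x : Cover n} (hx : R < |x.1|) (u v : Cover n) :
    g.chart.form x u v = u.1 * v.1 + warp β x.1 * inner ℝ u.2 v.2 :=
  hw (proj c x) hx u v

include hw in
theorem fderiv_form_of_warped (hβ : ContDiff ℝ ∞ β) {x : Cover n} (hx : R < |x.1|)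
    (w u v : Cover n) :
    fderiv ℝ g.chart.form x w u v =
      w.1 * (2 * (1 + deriv β x.1) * warp β x.1) * inner ℝ u.2 v.2 := by
  have h1 : HasFDerivAt (fun p => g.chart.form p u v) _ x :=
    ((g.chart.hasFDerivAt_form x).clm_apply (hasFDerivAt_const u x)).clm_apply
      (hasFDerivAt_const v x)
  have h2 : HasFDerivAt (fun p : Cover n => u.1 * v.1 + warp β p.1 * inner ℝ u.2 v.2) _ x :=
    (((hasDerivAt_warp hβ x.1).comp_hasFDerivAt x
      (hasFDerivAt_fst (𝕜 := ℝ) (E := ℝ) (F := EuclideanSpace ℝ (Fin n)))).mul_const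
      (inner ℝ u.2 v.2)).const_add (u.1 * v.1)
  have h3 := h1.unique (h2.congr_of_eventuallyEq (by
    filter_upwards [eventually_lt_abs_fst hx] with p hp using form_of_warped hw hp u v))
  have h4 := congrArg (fun L => L w) h3
  simp at h4
  rw [h4]
  ring

include hw in
theorem christoffel_of_warped (hβ : ContDiff ℝ ∞ β) {x : Cover n} (hx : R < |x.1|)
    (u v : Cover n) :
    g.chart.christoffel x u v = (-((1 + deriv β x.1) * warp β x.1 * inner ℝ u.2 v.2),
      (1 + deriv β x.1) • (u.1 • v.2 + v.1 • u.2)) := by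
  apply g.chart.form_injective x
  refine ContinuousLinearMap.ext fun z => ?_
  have h := g.chart.form_christoffel x u v z
  rw [fderiv_form_of_warped hw hβ hx, fderiv_form_of_warped hw hβ hx,
    fderiv_form_of_warped hw hβ hx] at h
  refine Eq.trans ?_ (form_of_warped hw hx _ z).symm
  simp only [inner_smul_left, inner_add_left, conj_trivial]
  linarith

include hw in
theorem fderiv_christoffel_of_warped (hβ : ContDiff ℝ ∞ β) {x : Cover n} (hx : R < |x.1|)
    (w u v : Cover n) :
    fderiv ℝ g.chart.christoffel x w u v =
      (-(w.1 * (deriv (deriv β) x.1 + 2 * (1 + deriv β x.1) ^ 2) * warp β x.1 * inner ℝ u.2 v.2),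
        (w.1 * deriv (deriv β) x.1) • (u.1 • v.2 + v.1 • u.2)) := by
  have hβ' : HasDerivAt (fun r => 1 + deriv β r) (deriv (deriv β) x.1) x.1 := by
    have : ContDiff ℝ ∞ (deriv β) := (contDiff_infty_iff_deriv.1 hβ).2
    exact (this.differentiable (by simp) x.1).hasDerivAt.const_add 1
  rw [← g.chart.fderiv_christoffel_apply]
  have h1 := (((hβ'.mul (hasDerivAt_warp hβ x.1)).comp_hasFDerivAt x
    (hasFDerivAt_fst (𝕜 := ℝ) (E := ℝ) (F := EuclideanSpace ℝ (Fin n)))).mul_const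
      (inner ℝ u.2 v.2)).neg
  have h2 := (hβ'.comp_hasFDerivAt x
    (hasFDerivAt_fst (𝕜 := ℝ) (E := ℝ) (F := EuclideanSpace ℝ (Fin n)))).smul_const
      (u.1 • v.2 + v.1 • u.2)
  have h3 : HasFDerivAt (fun p => g.chart.christoffel p u v) _ x :=
    (h1.prodMk h2).congr_of_eventuallyEq (by
      filter_upwards [eventually_lt_abs_fst hx] with p hp
      rw [christoffel_of_warped hw hβ hp u v]
      rfl)
  rw [h3.fderiv]
  refine Prod.ext ?_ ?_
  · simp
    ring
  · simp
    module

include hw in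
-- With f = e^{r+β}, the coefficients are f''/f = β'' + (1+β')² for planes containing ∂_r and
-- (f'/f)² = (1+β')² for planes tangent to the torus.
theorem curvature_of_warped (hβ : ContDiff ℝ ∞ β) {x : Cover n} (hx : R < |x.1|)
    (u v : Cover n) :
    g.chart.form x (g.chart.curvature x u v v) u =
      -((deriv (deriv β) x.1 + (1 + deriv β x.1) ^ 2) * warp β x.1 *
        ‖u.1 • v.2 - v.1 • u.2‖ ^ 2) -
      (1 + deriv β x.1) ^ 2 * warp β x.1 ^ 2 *
        (inner ℝ u.2 u.2 * inner ℝ v.2 v.2 - inner ℝ u.2 v.2 * inner ℝ u.2 v.2) := by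
  rw [form_of_warped hw hx, ChartMetric.curvature, ← real_inner_self_eq_norm_sq]
  simp only [fderiv_christoffel_of_warped hw hβ hx, christoffel_of_warped hw hβ hx,
    Prod.fst_add, Prod.fst_sub, Prod.snd_add, Prod.snd_sub, inner_add_left, inner_sub_left,
    inner_add_right, inner_sub_right, inner_smul_left, inner_smul_right, conj_trivial,
    real_inner_comm u.2 v.2]
  ring

include hw in
-- The bound 1/4 gives (1+β')² ≥ 9/16 > 1/4 ≥ -β''; the toral term has the right sign by
-- Cauchy–Schwarz.
theorem curvature_nonpos_of_warped (hβ : Admissible β R) {x : Cover n} (hx : R < |x.1|)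
    (u v : Cover n) : g.chart.form x (g.chart.curvature x u v v) u ≤ 0 := by
  rw [curvature_of_warped hw hβ.smooth hx]
  have hs := hβ.small x.1
  have h1 := abs_le.1 ((le_add_of_nonneg_right (abs_nonneg _)).trans hs)
  have h2 := abs_le.1 ((le_add_of_nonneg_left (abs_nonneg _)).trans hs)
  have h3 : 0 ≤ deriv (deriv β) x.1 + (1 + deriv β x.1) ^ 2 := by nlinarith [h1.1, h2.1]
  have h4 := real_inner_mul_inner_self_le u.2 v.2
  have h5 : 0 < warp β x.1 := Real.exp_pos _
  have h6 : 0 ≤ (1 + deriv β x.1) ^ 2 * warp β x.1 ^ 2 *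
      (inner ℝ u.2 u.2 * inner ℝ v.2 v.2 - inner ℝ u.2 v.2 * inner ℝ u.2 v.2) :=
    mul_nonneg (by positivity) (by linarith)
  have h7 : 0 ≤ (deriv (deriv β) x.1 + (1 + deriv β x.1) ^ 2) * warp β x.1 *
        ‖u.1 • v.2 - v.1 • u.2‖ ^ 2 := by positivity
  linarith

include hw in
theorem curvature_nonpos (hβ : Admissible β R) (hK : g.NonposCurvedOver {r : ℝ | |r| ≤ R})
    (x u v : Cover n) : g.chart.form x (g.chart.curvature x u v v) u ≤ 0 := by
  rcases lt_or_ge R |x.1| with hx | hx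
  · exact curvature_nonpos_of_warped hw hβ hx u v
  · refine g.chart.curvature_nonpos_of_sectional x (fun u v huv => ?_) u v
    have := hK x hx u v huv
    rwa [sectionalCurvature, curvature_eq] at this

include hw in
-- The constant 1 works in the ends and compactness supplies one in between. This bound yields both
-- completeness and the comparison of the Riemannian distance with r.
theorem exists_le_lift (hc : LinearIndependent ℝ c) :
    ∃ m, 0 < m ∧ ∀ x v : Cover n, m * v.1 ^ 2 ≤ g.lift x v v := by
  obtain ⟨m, hm, h⟩ := g.exists_lower_bound hc R
  refine ⟨min m 1, by positivity, fun x v => ?_⟩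
  rcases lt_or_ge R |x.1| with hx | hx
  · have h1 : g.lift x v v = v.1 * v.1 + warp β x.1 * inner ℝ v.2 v.2 := form_of_warped hw hx v v
    have h2 : 0 ≤ warp β x.1 * inner ℝ v.2 v.2 :=
      mul_nonneg (Real.exp_pos _).le real_inner_self_nonneg
    calc min m 1 * v.1 ^ 2 ≤ 1 * v.1 ^ 2 := by gcongr; exact min_le_right _ _
      _ ≤ g.lift x v v := by rw [h1]; nlinarith
  · refine le_trans ?_ (h x hx v)
    have : |v.1| ≤ ‖v‖ := norm_fst_le v
    rw [← sq_abs v.1]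
    gcongr
    exact min_le_left _ _

end Metric

end CuspFunnel

end

/-! ### Construction of the horospherical normal coordinates -/

noncomputable section

set_option maxSynthPendingDepth 3

namespace CuspFunnel

open Set

variable {n : ℕ} {c : Fin n → EuclideanSpace ℝ (Fin n)}

namespace Metric

theorem christoffel_sub_lattice (g : Metric c) (x : Cover n) {l : EuclideanSpace ℝ (Fin n)}
    (hl : l ∈ lattice c) : g.chart.christoffel (x - (0, l)) = g.chart.christoffel x := by
  have h : (fun p => g.chart.form (p - (0, l))) = g.chart.form := by
    funext p
    have := g.lift_sub_lattice p hl
    simpa [chart, Prod.sub_def] using this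
  have h1 : g.chart.form (x - (0, l)) = g.chart.form x := congrFun h x
  have h2 : fderiv ℝ g.chart.form (x - (0, l)) = fderiv ℝ g.chart.form x := by
    simp only [sub_eq_add_neg] at h ⊢
    rw [← fderiv_comp_add_right, h]
  simp only [ChartMetric.christoffel, h1, h2]

end Metric

/-- Geodesic normal coordinates `(s, y) ↦ Φ (s, y)` based on a horosphere in the cusp: the curves
`Φ (·, y)` are geodesics with velocity `N`, which are the vertical lines `r = s` for `s < -R`.
The fields `J` and `W` are the derivatives of `Φ` and `N` in `y`. -/
structure NormalCoordinates (g : Metric c) (R : ℝ) where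
  Φ : Cover n → Cover n
  N : Cover n → Cover n
  J : Cover n → EuclideanSpace ℝ (Fin n) →L[ℝ] Cover n
  W : Cover n → EuclideanSpace ℝ (Fin n) →L[ℝ] Cover n
  hasStrictFDerivAt_Φ : ∀ q, HasStrictFDerivAt Φ
    ((ContinuousLinearMap.toSpanSingleton ℝ (N q)).coprod (J q)) q
  hasStrictFDerivAt_N : ∀ q, HasStrictFDerivAt N
    ((ContinuousLinearMap.toSpanSingleton ℝ (-g.chart.christoffel (Φ q) (N q) (N q))).coprod
      (W q)) q
  hasDerivAt_J : ∀ s y w, HasDerivAt (fun s => J (s, y) w) (W (s, y) w) s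
  hasDerivAt_W : ∀ s y w, HasDerivAt (fun s => W (s, y) w)
    (-(fderiv ℝ g.chart.christoffel (Φ (s, y)) (J (s, y) w) (N (s, y)) (N (s, y))
      + (2 : ℝ) • g.chart.christoffel (Φ (s, y)) (N (s, y)) (W (s, y) w))) s
  Φ_of_lt : ∀ q : Cover n, q.1 < -R → Φ q = q
  Φ_sub_lattice : ∀ q : Cover n, ∀ l ∈ lattice c, Φ (q - (0, l)) = Φ q - (0, l)

/-- The geodesic flow is applied for time s - r₀ to the upward unit vectors on the slice r = r₀
inside the cusp. The equations for `J` and `W` are the linearized flow; the last two fields follow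
from uniqueness, since vertical lines are geodesics in the cusp and the flow is lattice equivariant.
-/
theorem exists_normalCoordinates {g : Metric c} {R : ℝ} (hR : 0 < R) {β : ℝ → ℝ}
    (hβ : ContDiff ℝ ∞ β) (hb : NoBlowUp g.chart.geodesicField)
    (hw : ∀ p : Cylinder c, R < |p.1| → ∀ u v : Cover n,
      g.form p u v = warpedForm p.1 (β p.1) u v) :
    Nonempty (NormalCoordinates g R) := by
  have hf2 : ContDiff ℝ 2 g.chart.geodesicField := g.chart.contDiff_geodesicField.of_le
    (WithTop.coe_le_coe.2 le_top)
  have hf1 : ContDiff ℝ 1 g.chart.geodesicField := hf2.of_le (by norm_num)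
  obtain ⟨F, hF⟩ := hb.exists_isFlow hf1
  obtain ⟨D, hD0, hDd, hDF⟩ := hF.exists_hasStrictFDerivAt hb hf2
  set r₀ : ℝ := -R - 1 with hr₀
  let ini : EuclideanSpace ℝ (Fin n) → Cover n × Cover n := fun y => ((r₀, y), (1, 0))
  let κ : EuclideanSpace ℝ (Fin n) →L[ℝ] Cover n × Cover n :=
    (ContinuousLinearMap.inl ℝ (Cover n) (Cover n)).comp
      (ContinuousLinearMap.inr ℝ ℝ (EuclideanSpace ℝ (Fin n)))
  have hκ : ∀ w, κ w = ((0, w), 0) := fun w => rfl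
  let Z : Cover n → Cover n × Cover n := fun q => F (q.1 - r₀) (ini q.2)
  let Z' : Cover n → EuclideanSpace ℝ (Fin n) →L[ℝ] Cover n × Cover n :=
    fun q => (D (q.1 - r₀) (ini q.2)).comp κ
  have hZ : ∀ q, HasStrictFDerivAt Z ((ContinuousLinearMap.toSpanSingleton ℝ
      (g.chart.geodesicField (Z q))).coprod (Z' q)) q := by
    intro q
    have h1 : HasStrictFDerivAt (fun q : Cover n => (q.1 - r₀, ini q.2))
        ((ContinuousLinearMap.fst ℝ ℝ (EuclideanSpace ℝ (Fin n))).prod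
          (κ.comp (ContinuousLinearMap.snd ℝ ℝ (EuclideanSpace ℝ (Fin n))))) q := by
      have h2 : HasStrictFDerivAt (fun q : Cover n => κ q.2 + ((r₀, 0), (1, 0)))
          (κ.comp (ContinuousLinearMap.snd ℝ ℝ (EuclideanSpace ℝ (Fin n)))) q :=
        (κ.comp (ContinuousLinearMap.snd ℝ ℝ
          (EuclideanSpace ℝ (Fin n)))).hasStrictFDerivAt.add_const _
      have h3 : (fun q : Cover n => κ q.2 + ((r₀, 0), (1, 0))) = fun q : Cover n => ini q.2 := by
        funext q
        simp [hκ, ini]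
      rw [h3] at h2
      exact ((ContinuousLinearMap.fst ℝ ℝ
        (EuclideanSpace ℝ (Fin n))).hasStrictFDerivAt.sub_const r₀).prodMk h2
    refine ((hDF (q.1 - r₀) (ini q.2)).comp q h1).congr_fderiv ?_
    ext p <;> simp [Z, Z']
  have hZd : ∀ s y, HasDerivAt (fun s => Z (s, y)) (g.chart.geodesicField (Z (s, y))) s :=
    fun s y => by
      have := (hF.deriv (ini y) (s - r₀)).comp_sub_const s r₀
      exact this
  have hZ'd : ∀ s y w, HasDerivAt (fun s => Z' (s, y) w)
      (fderiv ℝ g.chart.geodesicField (Z (s, y)) (Z' (s, y) w)) s := fun s y w => by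
    have := (hDd (ini y) (κ w) (s - r₀)).comp_sub_const s r₀
    exact this
  have hZ0 : ∀ y, Z (r₀, y) = ini y := fun y => by simp [Z, hF.zero]
  refine ⟨⟨fun q => (Z q).1, fun q => (Z q).2,
    fun q => (ContinuousLinearMap.fst ℝ (Cover n) (Cover n)).comp (Z' q),
    fun q => (ContinuousLinearMap.snd ℝ (Cover n) (Cover n)).comp (Z' q), ?_, ?_, ?_, ?_, ?_, ?_⟩⟩
  · intro q
    refine (hZ q).fst.congr_fderiv ?_
    ext p <;> simp [ChartMetric.geodesicField]
  · intro q
    refine (hZ q).snd.congr_fderiv ?_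
    ext p <;> simp [ChartMetric.geodesicField]
  · intro s y w
    have := (hZ'd s y w).fst
    rw [g.chart.fderiv_geodesicField] at this
    exact this
  · intro s y w
    have := (hZ'd s y w).snd
    rw [g.chart.fderiv_geodesicField] at this
    exact this
  · rintro ⟨s, y⟩ hs
    have := integralCurve_eqOn_Ioo hf1 (a := min s r₀ - 1) (b := -R) (t₀ := r₀)
      (α := fun s => Z (s, y)) (α' := fun s => ((s, y), (1, 0)))
      ⟨by linarith [min_le_right s r₀], by linarith⟩ (fun s _ => hZd s y) (fun s hs => by
        have hs' : R < |s| := by rw [abs_of_neg (by linarith [hs.2])]; linarith [hs.2]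
        have h1 : g.chart.geodesicField ((s, y), (1, 0)) = ((1, 0), (0, 0)) := by
          have h2 := Metric.christoffel_of_warped hw hβ (x := (s, y)) hs' (1, 0) (1, 0)
          simp [ChartMetric.geodesicField, h2]
        rw [h1]
        exact ((hasDerivAt_id s).prodMk (hasDerivAt_const s y)).prodMk (hasDerivAt_const s _))
      (hZ0 y) (show s ∈ Ioo _ _ from ⟨by linarith [min_le_left s r₀], hs⟩)
    exact congrArg Prod.fst this
  · rintro ⟨s, y⟩ l hl
    have := integralCurve_eq hf1 (t₀ := r₀) (α := fun s => Z (s, y - l))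
      (α' := fun s => Z (s, y) - ((0, l), 0)) (fun s => hZd s (y - l)) (fun s => by
        refine ((hZd s y).sub_const ((0, l), 0)).congr_deriv ?_
        simp [ChartMetric.geodesicField, g.christoffel_sub_lattice _ hl])
      (by simp [hZ0, ini]) s
    simpa using congrArg Prod.fst this

end CuspFunnel

end

/-! ### Gauss lemma and growth of the Jacobi fields -/

noncomputable section

set_option maxSynthPendingDepth 3

namespace CuspFunnel

open Set

variable {n : ℕ} {c : Fin n → EuclideanSpace ℝ (Fin n)} {g : Metric c} {R : ℝ}

namespace NormalCoordinates

variable (nc : NormalCoordinates g R)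

/-- The differential of the normal coordinates. -/
def dΦ (q : Cover n) : Cover n →L[ℝ] Cover n :=
  (ContinuousLinearMap.toSpanSingleton ℝ (nc.N q)).coprod (nc.J q)

theorem dΦ_apply (q u : Cover n) : nc.dΦ q u = u.1 • nc.N q + nc.J q u.2 := by
  simp [dΦ]

/-- The covariant derivative of the Jacobi field `J q w` along the geodesic `Φ (·, y)`. -/
def covJ (q : Cover n) (w : EuclideanSpace ℝ (Fin n)) : Cover n :=
  nc.W q w + g.chart.christoffel (nc.Φ q) (nc.N q) (nc.J q w)

theorem hasDerivAt_Φ (s : ℝ) (y : EuclideanSpace ℝ (Fin n)) :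
    HasDerivAt (fun s => nc.Φ (s, y)) (nc.N (s, y)) s := by
  have := (nc.hasStrictFDerivAt_Φ (s, y)).hasFDerivAt.comp_hasDerivAt s
    ((hasDerivAt_id s).prodMk (hasDerivAt_const s y))
  simpa [Function.comp_def] using this

theorem hasDerivAt_N (s : ℝ) (y : EuclideanSpace ℝ (Fin n)) :
    HasDerivAt (fun s => nc.N (s, y))
      (-g.chart.christoffel (nc.Φ (s, y)) (nc.N (s, y)) (nc.N (s, y))) s := by
  have := (nc.hasStrictFDerivAt_N (s, y)).hasFDerivAt.comp_hasDerivAt s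
    ((hasDerivAt_id s).prodMk (hasDerivAt_const s y))
  simpa [Function.comp_def] using this

theorem dΦ_of_lt {q : Cover n} (hq : q.1 < -R) : nc.dΦ q = ContinuousLinearMap.id ℝ _ := by
  refine (nc.hasStrictFDerivAt_Φ q).hasFDerivAt.unique ((hasFDerivAt_id q).congr_of_eventuallyEq ?_)
  filter_upwards [(isOpen_lt continuous_fst continuous_const).mem_nhds hq] with p hp
  exact nc.Φ_of_lt p hp

theorem N_of_lt {q : Cover n} (hq : q.1 < -R) : nc.N q = (1, 0) := by
  have := nc.dΦ_apply q (1, 0)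
  rw [nc.dΦ_of_lt hq] at this
  simpa using this.symm

theorem J_of_lt {q : Cover n} (hq : q.1 < -R) (w : EuclideanSpace ℝ (Fin n)) :
    nc.J q w = (0, w) := by
  have := nc.dΦ_apply q (0, w)
  rw [nc.dΦ_of_lt hq] at this
  simpa using this.symm

theorem W_of_lt {q : Cover n} (hq : q.1 < -R) (w : EuclideanSpace ℝ (Fin n)) :
    nc.W q w = 0 := by
  have h := (nc.hasStrictFDerivAt_N q).hasFDerivAt.unique
    ((hasFDerivAt_const (1, 0) q).congr_of_eventuallyEq (by
      filter_upwards [(isOpen_lt continuous_fst continuous_const).mem_nhds hq] with p hp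
      exact nc.N_of_lt hp))
  simpa using congrArg (fun L => L (0, w)) h

variable {β : ℝ → ℝ} (hR : 0 < R)
  (hw : ∀ p : Cylinder c, R < |p.1| → ∀ u v : Cover n,
    g.form p u v = warpedForm p.1 (β p.1) u v)

theorem lt_abs_of_lt {q : Cover n} (hR : 0 < R) (hq : q.1 < -R) : R < |q.1| := by
  rw [abs_of_neg (by linarith)]
  linarith

include hR hw in
theorem form_N_N (q : Cover n) : g.chart.form (nc.Φ q) (nc.N q) (nc.N q) = 1 := by
  obtain ⟨s, y⟩ := q
  have hd : ∀ s, HasDerivAt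
      (fun s => g.chart.form (nc.Φ (s, y)) (nc.N (s, y)) (nc.N (s, y))) 0 s := fun s => by
    simpa using g.chart.hasDerivAt_form_along (nc.hasDerivAt_Φ s y) (nc.hasDerivAt_N s y)
      (nc.hasDerivAt_N s y)
  have hlt : ((-R - 1, y) : Cover n).1 < -R := by simp
  have := is_const_of_deriv_eq_zero (fun s => (hd s).differentiableAt) (fun s => (hd s).deriv) s
    (-R - 1)
  rw [this, nc.N_of_lt hlt, nc.Φ_of_lt _ hlt,
    Metric.form_of_warped hw (lt_abs_of_lt hR hlt)]
  simp

include hR hw in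
-- Differentiate g(N, N) = 1 in the direction w, using that the covariant derivative of N in that
-- direction is ∇J.
theorem form_N_covJ (q : Cover n) (w : EuclideanSpace ℝ (Fin n)) :
    g.chart.form (nc.Φ q) (nc.N q) (nc.covJ q w) = 0 := by
  have hc : HasDerivAt (fun t : ℝ => ((q.1, q.2 + t • w) : Cover n)) (0, w) 0 := by
    refine (hasDerivAt_const _ _).prodMk ?_
    simpa using ((hasDerivAt_id (0 : ℝ)).smul_const w).const_add q.2
  have hq : ((q.1, q.2 + (0 : ℝ) • w) : Cover n) = q := by simp
  have hΦ : HasDerivAt (fun t : ℝ => nc.Φ (q.1, q.2 + t • w)) (nc.J q w) 0 := by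
    have h1 := nc.hasStrictFDerivAt_Φ q
    rw [← hq] at h1
    simpa [Function.comp_def] using h1.hasFDerivAt.comp_hasDerivAt 0 hc
  have hN : HasDerivAt (fun t : ℝ => nc.N (q.1, q.2 + t • w)) (nc.W q w) 0 := by
    have h1 := nc.hasStrictFDerivAt_N q
    rw [← hq] at h1
    simpa [Function.comp_def] using h1.hasFDerivAt.comp_hasDerivAt 0 hc
  have h1 := g.chart.hasDerivAt_form_along hΦ hN hN
  simp only [nc.form_N_N hR hw, hq] at h1
  have h2 := h1.unique (hasDerivAt_const _ _)
  rw [g.chart.symm _ (nc.N q), g.chart.christoffel_symm _ (nc.J q w)] at h2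
  rw [covJ, g.chart.symm]
  linarith

include hR hw in
-- Gauss lemma: along a line the derivative of g(N, J) is g(N, ∇J) = 0, and in the cusp N and J are
-- visibly orthogonal.
theorem form_N_J (q : Cover n) (w : EuclideanSpace ℝ (Fin n)) :
    g.chart.form (nc.Φ q) (nc.N q) (nc.J q w) = 0 := by
  obtain ⟨s, y⟩ := q
  have hd : ∀ s, HasDerivAt
      (fun s => g.chart.form (nc.Φ (s, y)) (nc.N (s, y)) (nc.J (s, y) w)) 0 s := fun s => by
    refine (g.chart.hasDerivAt_form_along (nc.hasDerivAt_Φ s y) (nc.hasDerivAt_N s y)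
      (nc.hasDerivAt_J s y w)).congr_deriv ?_
    have := nc.form_N_covJ hR hw (s, y) w
    rw [covJ] at this
    rw [this]
    simp
  have hlt : ((-R - 1, y) : Cover n).1 < -R := by simp
  have := is_const_of_deriv_eq_zero (fun s => (hd s).differentiableAt) (fun s => (hd s).deriv) s
    (-R - 1)
  rw [this, nc.N_of_lt hlt, nc.J_of_lt hlt, nc.Φ_of_lt _ hlt,
    Metric.form_of_warped hw (lt_abs_of_lt hR hlt)]
  simp

include hR hw in
theorem form_dΦ (q u : Cover n) :
    g.chart.form (nc.Φ q) (nc.dΦ q u) (nc.dΦ q u) =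
      u.1 ^ 2 + g.chart.form (nc.Φ q) (nc.J q u.2) (nc.J q u.2) := by
  rw [dΦ_apply]
  simp only [map_add, map_smul, add_apply, smul_apply, smul_eq_mul, nc.form_N_N hR hw,
    nc.form_N_J hR hw, g.chart.symm _ (nc.J q u.2) (nc.N q)]
  ring

include hR hw in
theorem form_N_dΦ (q u : Cover n) :
    g.chart.form (nc.Φ q) (nc.dΦ q u) (nc.N q) = u.1 := by
  rw [dΦ_apply]
  simp [nc.form_N_N hR hw, nc.form_N_J hR hw, g.chart.symm _ (nc.J q u.2) (nc.N q)]

variable (hβ : Admissible β R)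
  (hK : ∀ x u v : Cover n, g.chart.form x (g.chart.curvature x u v v) u ≤ 0)

include hR hw hβ hK in
-- By the Jacobi equation the derivative along the line is |∇J|² - g(R(J, N)N, J) ≥ 0, and in the
-- cusp the quantity equals (1+β') e^{2(s+β)} |w|² > 0. This is the strict convexity of horospheres.
theorem form_covJ_J_pos (q : Cover n) {w : EuclideanSpace ℝ (Fin n)} (hw0 : w ≠ 0) :
    0 < g.chart.form (nc.Φ q) (nc.covJ q w) (nc.J q w) := by
  obtain ⟨s, y⟩ := q
  have hmono : Monotone fun s =>
      g.chart.form (nc.Φ (s, y)) (nc.covJ (s, y) w) (nc.J (s, y) w) :=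
    monotone_of_hasDerivAt_nonneg (fun s => g.chart.hasDerivAt_jacobi_inner (nc.hasDerivAt_Φ s y)
      (nc.hasDerivAt_N s y) (nc.hasDerivAt_J s y w) (nc.hasDerivAt_W s y w))
      (fun s => sub_nonneg.2 ((hK _ _ _).trans (g.chart.self_nonneg _ _)))
  refine lt_of_lt_of_le ?_ (hmono (min_le_left s (-R - 1)))
  set s' := min s (-R - 1)
  have hlt : ((s', y) : Cover n).1 < -R :=
    (min_le_right s (-R - 1)).trans_lt (by linarith)
  have habs := lt_abs_of_lt hR hlt
  have hβ' := abs_le.1 ((le_add_of_nonneg_right (abs_nonneg _)).trans (hβ.small s'))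
  simp only [covJ, nc.W_of_lt hlt, nc.N_of_lt hlt, nc.J_of_lt hlt, nc.Φ_of_lt _ hlt,
    Metric.christoffel_of_warped hw hβ.smooth habs, Metric.form_of_warped hw habs]
  have h1 : 0 < Metric.warp β s' := Real.exp_pos _
  have h2 : 0 < inner ℝ w w := real_inner_self_pos.2 hw0
  have h3 : 0 < 1 + deriv β s' := by linarith [hβ'.1]
  simp [inner_smul_left]
  positivity

include hR hw hβ hK in
theorem monotone_form_J_J (y w : EuclideanSpace ℝ (Fin n)) :
    Monotone fun s => g.chart.form (nc.Φ (s, y)) (nc.J (s, y) w) (nc.J (s, y) w) := by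
  refine monotone_of_hasDerivAt_nonneg (fun s => g.chart.hasDerivAt_jacobi_norm_sq
    (v := fun s => nc.N (s, y)) (W := fun s => nc.W (s, y) w) (nc.hasDerivAt_Φ s y) (nc.hasDerivAt_J s y w)) fun s => ?_
  rcases eq_or_ne w 0 with rfl | hw0
  · simp
  · have := nc.form_covJ_J_pos hR hw hβ hK (s, y) hw0
    rw [covJ] at this
    simp only [Pi.zero_apply]
    linarith

include hR hw hβ hK in
/-- The metric dominates a fixed multiple of the Euclidean one along the horospheres of height at
least `-S`. -/
theorem le_form_J_J {S : ℝ} (hS : R < S) {q : Cover n} (hq : -S ≤ q.1)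
    (w : EuclideanSpace ℝ (Fin n)) :
    Metric.warp β (-S) * ‖w‖ ^ 2 ≤ g.chart.form (nc.Φ q) (nc.J q w) (nc.J q w) := by
  refine le_trans (le_of_eq ?_) (nc.monotone_form_J_J hR hw hβ hK q.2 w hq)
  have hlt : ((-S, q.2) : Cover n).1 < -R := neg_lt_neg hS
  simp [nc.J_of_lt hlt, nc.Φ_of_lt _ hlt, Metric.form_of_warped hw (lt_abs_of_lt hR hlt)]

include hR hw hβ hK in
theorem form_J_J_pos (q : Cover n) {w : EuclideanSpace ℝ (Fin n)} (hw0 : w ≠ 0) :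
    0 < g.chart.form (nc.Φ q) (nc.J q w) (nc.J q w) := by
  have h := nc.le_form_J_J hR hw hβ hK (S := max (R + 1) (-q.1)) (q := q)
    ((lt_add_one R).trans_le (le_max_left _ _)) (by linarith [le_max_right (R + 1) (-q.1)]) w
  refine lt_of_lt_of_le ?_ h
  have : 0 < ‖w‖ := norm_pos_iff.2 hw0
  have : 0 < Metric.warp β (-max (R + 1) (-q.1)) := Real.exp_pos _
  positivity

include hR hw hβ hK in
theorem dΦ_injective (q : Cover n) : Function.Injective (nc.dΦ q) := by
  rw [injective_iff_map_eq_zero]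
  intro u hu
  have h := nc.form_dΦ hR hw q u
  rw [hu] at h
  simp only [map_zero] at h
  have h0 := g.chart.self_nonneg (nc.Φ q) (nc.J q u.2)
  have h2 : u.2 = 0 := by
    by_contra hne
    have := nc.form_J_J_pos hR hw hβ hK q hne
    nlinarith [sq_nonneg u.1]
  have h1 : u.1 = 0 := by
    refine pow_eq_zero_iff two_ne_zero |>.1 ?_
    nlinarith [sq_nonneg u.1]
  exact Prod.ext h1 h2

include hR hw hβ hK in
theorem exists_equiv_dΦ (q : Cover n) : ∃ L : Cover n ≃L[ℝ] Cover n,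
    (L : Cover n →L[ℝ] Cover n) = nc.dΦ q :=
  ⟨(LinearEquiv.ofInjectiveEndo (nc.dΦ q : Cover n →ₗ[ℝ] Cover n)
    (nc.dΦ_injective hR hw hβ hK q)).toContinuousLinearEquiv, rfl⟩

include hR hw hβ hK in
theorem isLocalHomeomorph_Φ : IsLocalHomeomorph nc.Φ := by
  intro q
  obtain ⟨L, hL⟩ := nc.exists_equiv_dΦ hR hw hβ hK q
  have h : HasStrictFDerivAt nc.Φ (L : Cover n →L[ℝ] Cover n) q := by
    rw [hL]
    exact nc.hasStrictFDerivAt_Φ q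
  exact ⟨h.toOpenPartialHomeomorph nc.Φ, h.mem_toOpenPartialHomeomorph_source, rfl⟩

end NormalCoordinates

end CuspFunnel

end

/-! ### Lifting paths through local homeomorphisms -/

noncomputable section

set_option maxSynthPendingDepth 3

namespace CuspFunnel

open Set Filter Topology

/-- A path lifts through a local homeomorphism if the end points of its partial lifts stay in a
compact set. -/
theorem exists_lift_of_compact {X Y : Type*} [MetricSpace X] [TopologicalSpace Y] [T2Space Y]
    {Φ : X → Y} (hΦ : IsLocalHomeomorph Φ) {γ : ℝ → Y} (hγ : Continuous γ) {q₀ : X}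
    (h0 : Φ q₀ = γ 0) {K : Set X} (hK : IsCompact K)
    (hb : ∀ T ∈ Icc (0 : ℝ) 1, ∀ Γ : ℝ → X, ContinuousOn Γ (Icc 0 T) → Γ 0 = q₀ →
      (∀ t ∈ Icc 0 T, Φ (Γ t) = γ t) → Γ T ∈ K) :
    ∃ Γ : ℝ → X, ContinuousOn Γ (Icc 0 1) ∧ Γ 0 = q₀ ∧ ∀ t ∈ Icc (0 : ℝ) 1, Φ (Γ t) = γ t := by
  let S : Set ℝ := {T | T ∈ Icc (0 : ℝ) 1 ∧ ∃ Γ : ℝ → X, ContinuousOn Γ (Icc 0 T) ∧ Γ 0 = q₀ ∧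
    ∀ t ∈ Icc 0 T, Φ (Γ t) = γ t}
  have hS0 : (0 : ℝ) ∈ S := ⟨by simp, fun _ => q₀, continuousOn_const, rfl, fun t ht => by
    have : t = 0 := by simpa using ht
    rw [this, h0]⟩
  have hbdd : BddAbove S := ⟨1, fun T hT => hT.1.2⟩
  obtain ⟨u, -, hu, huS⟩ := exists_seq_tendsto_sSup ⟨0, hS0⟩ hbdd
  set T := sSup S
  choose hu01 Γ hΓc hΓ0 hΓ using huS
  have hmem : ∀ k, Γ k (u k) ∈ K := fun k => hb _ (hu01 k) _ (hΓc k) (hΓ0 k) (hΓ k)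
  -- End points of lifts up to times tending to the supremum T accumulate at some q over γ(T). The
  -- local inverse of Φ near q then prolongs such a lift to min(1, T + δ/2), which forces this time
  -- to be 1.
  obtain ⟨q, -, φ, hφ, hlim⟩ := hK.tendsto_subseq hmem
  have huφ : Tendsto (u ∘ φ) atTop (𝓝 T) := hu.comp hφ.tendsto_atTop
  have hΦq : Φ q = γ T := by
    refine tendsto_nhds_unique ((hΦ.continuous.tendsto q).comp hlim) ?_
    refine ((hγ.tendsto T).comp huφ).congr fun k => ?_
    exact (hΓ (φ k) (u (φ k)) ⟨(hu01 _).1, le_rfl⟩).symm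
  obtain ⟨e, hqe, rfl⟩ := hΦ q
  have hTt : γ T ∈ e.target := hΦq ▸ e.map_source hqe
  obtain ⟨δ, hδ, hball⟩ := Metric.mem_nhds_iff.1
    ((e.open_target.preimage hγ).mem_nhds hTt)
  obtain ⟨k, hk1, hk2⟩ := ((hlim.eventually (e.open_source.mem_nhds hqe)).and
    (huφ.eventually (Metric.ball_mem_nhds T hδ))).exists
  simp only [Function.comp_apply] at hk1 hk2
  set t₁ := u (φ k)
  have ht₁ : t₁ ∈ Icc (0 : ℝ) 1 := hu01 _
  have ht₁T : t₁ ≤ T := le_csSup hbdd ⟨ht₁, _, hΓc _, hΓ0 _, hΓ _⟩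
  set T₂ := min 1 (T + δ / 2)
  have h12 : t₁ ≤ T₂ := le_min ht₁.2 (by linarith)
  have hk3 : T - δ < t₁ := by
    have hd : dist t₁ T < δ := hk2
    rw [Real.dist_eq] at hd
    linarith [(abs_lt.1 hd).1]
  rw [Real.ball_eq_Ioo] at hball
  have htar : ∀ t ∈ Icc t₁ T₂, γ t ∈ e.target := fun t ht =>
    hball ⟨hk3.trans_le ht.1, lt_of_le_of_lt (ht.2.trans (min_le_right _ _)) (by linarith)⟩
  let Γ' : ℝ → X := fun t => if t ≤ t₁ then Γ (φ k) t else e.symm (γ t)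
  have hleft : ∀ t ∈ Icc 0 t₁, Γ' t = Γ (φ k) t := fun t ht => if_pos ht.2
  have hright : ∀ t ∈ Icc t₁ T₂, Γ' t = e.symm (γ t) := fun t ht => by
    rcases ht.1.eq_or_lt with h | h
    · rw [← h, hleft t₁ ⟨ht₁.1, le_rfl⟩, ← hΓ (φ k) t₁ ⟨ht₁.1, le_rfl⟩, e.left_inv hk1]
    · exact if_neg (not_le.2 h)
  have hT₂S : T₂ ∈ S := by
    refine ⟨⟨ht₁.1.trans h12, min_le_left _ _⟩, Γ', ?_, ?_, ?_⟩
    · rw [← Icc_union_Icc_eq_Icc ht₁.1 h12]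
      refine ContinuousOn.union_of_isClosed ((hΓc (φ k)).congr hleft) ?_ isClosed_Icc isClosed_Icc
      exact (e.continuousOn_symm.comp hγ.continuousOn htar).congr hright
    · rw [hleft 0 ⟨le_rfl, ht₁.1⟩, hΓ0]
    · intro t ht
      rcases le_total t t₁ with h | h
      · rw [hleft t ⟨ht.1, h⟩, hΓ _ t ⟨ht.1, h⟩]
      · rw [hright t ⟨h, ht.2⟩, e.right_inv (htar t ⟨h, ht.2⟩)]
  have hle : T₂ ≤ T := le_csSup hbdd hT₂S
  have h1 : T₂ = 1 := by
    rcases min_choice 1 (T + δ / 2) with h | h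
    · exact h
    · have : T + δ / 2 ≤ T := h ▸ hle
      linarith
  rw [h1] at hT₂S
  exact hT₂S.2

/-- A local homeomorphism of real vector spaces through which all segments from `Φ q₀` lift,
starting at `q₀`, is invertible. -/
theorem exists_continuous_inverse_of_lift {E : Type*} [NormedAddCommGroup E] [NormedSpace ℝ E]
    {Φ : E → E} (hΦ : IsLocalHomeomorph Φ) (q₀ : E)
    (hl : ∀ d : E, ∃ Γ : ℝ → E, ContinuousOn Γ (Icc 0 1) ∧ Γ 0 = q₀ ∧
      ∀ t ∈ Icc (0 : ℝ) 1, Φ (Γ t) = Φ q₀ + t • d) :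
    ∃ Ψ : E → E, Continuous Ψ ∧ (∀ p, Φ (Ψ p) = p) ∧ ∀ q, Ψ (Φ q) = q := by
  have sep : IsSeparatedMap Φ := T2Space.isSeparatedMap Φ
  choose Γ hΓc hΓ0 hΓ using hl
  let f : C(unitInterval × E, E) := ⟨fun p => Φ q₀ + (p.1 : ℝ) • (p.2 - Φ q₀), by fun_prop⟩
  let G : unitInterval × E → E := fun p => Γ (p.2 - Φ q₀) p.1
  have hGc : ∀ p, Continuous fun t => G (t, p) := fun p => by
    exact (hΓc (p - Φ q₀)).comp_continuous continuous_subtype_val fun t => t.2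
  have hG0 : ∀ p, G (0, p) = q₀ := fun p => hΓ0 _
  have hGf : ∀ x, Φ (G x) = f x := fun x => hΓ _ _ x.1.2
  -- The segment lifts, each continuous in time and all starting at `q₀`, form a jointly continuous
  -- lift of the straight-line contraction. Its end points define a section of Φ, and uniqueness of
  -- lifts makes that a two-sided inverse.
  have hG : Continuous G := hΦ.continuous_lift sep f (funext hGf)
    (by simp only [hG0]; exact continuous_const) hGc
  have hΨ : Continuous fun p => G (1, p) := hG.comp (by fun_prop)
  have hΦΨ : ∀ p, Φ (G (1, p)) = p := fun p => by
    rw [hGf]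
    simp [f]
  refine ⟨fun p => G (1, p), hΨ, hΦΨ, fun q => ?_⟩
  have hbase : G (1, Φ q₀) = q₀ := by
    have := sep.eq_of_comp_eq hΦ.isLocallyInjective (hGc (Φ q₀)) continuous_const
      (funext fun t => by
        simp only [Function.comp_apply, hGf]
        simp [f]) (0 : unitInterval) (hG0 (Φ q₀))
    exact congrFun this 1
  have := sep.eq_of_comp_eq hΦ.isLocallyInjective (hΨ.comp hΦ.continuous) continuous_id
    (funext fun q => by simp [hΦΨ]) q₀ hbase
  exact congrFun this q

/-! ### The normal coordinates are global, and heights are convex along geodesics -/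

variable {n : ℕ} {c : Fin n → EuclideanSpace ℝ (Fin n)} {g : Metric c} {R : ℝ}

namespace NormalCoordinates

variable (nc : NormalCoordinates g R) {β : ℝ → ℝ} (hR : 0 < R)
  (hw : ∀ p : Cylinder c, R < |p.1| → ∀ u v : Cover n,
    g.form p u v = warpedForm p.1 (β p.1) u v)
  (hβ : Admissible β R)
  (hK : ∀ x u v : Cover n, g.chart.form x (g.chart.curvature x u v v) u ≤ 0)

include hR hw hβ hK in
-- A continuous lift inherits differentiability because dΦ is invertible; the version within a set
-- is needed at the end points of partial lifts.
theorem hasDerivWithinAt_lift {Γ γ : ℝ → Cover n} {d : Cover n} {s : Set ℝ} {t : ℝ} (ht : t ∈ s)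
    (hΓ : ContinuousWithinAt Γ s t) (hγ : HasDerivWithinAt γ d s t)
    (h : ∀ t ∈ s, nc.Φ (Γ t) = γ t) :
    ∃ u, HasDerivWithinAt Γ u s t ∧ nc.dΦ (Γ t) u = d := by
  obtain ⟨L, hL⟩ := nc.exists_equiv_dΦ hR hw hβ hK (Γ t)
  have h1 : HasFDerivWithinAt nc.Φ (nc.dΦ (Γ t)) univ (Γ t) :=
    (nc.hasStrictFDerivAt_Φ (Γ t)).hasFDerivAt.hasFDerivWithinAt
  have h2 := HasFDerivWithinAt.of_comp_of_leftInverse (f'symm := (L.symm : Cover n →L[ℝ] Cover n))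
    (by rw [nhdsWithin_univ]; exact hΓ) h1 hγ.hasFDerivWithinAt
    (eventually_nhdsWithin_of_forall h) (fun u => by rw [← hL]; exact L.symm_apply_apply u) ht
  refine ⟨L.symm d, ?_, by rw [← hL]; exact L.apply_symm_apply d⟩
  simpa using h2.hasDerivWithinAt

include hR hw hβ hK in
-- The speed of a lift (s, y) in ds² + g(J, J) is that of the segment, at most `C`. So s moves by at
-- most `C` and stays above -S, where g(J, J) dominates a fixed multiple of |dy|²; hence y moves by
-- at most `C'`, and partial lifts stay in a ball.
theorem exists_segment_lift (q₀ d : Cover n) : ∃ Γ : ℝ → Cover n, ContinuousOn Γ (Icc 0 1) ∧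
    Γ 0 = q₀ ∧ ∀ t ∈ Icc (0 : ℝ) 1, nc.Φ (Γ t) = nc.Φ q₀ + t • d := by
  have hγ : Continuous fun t : ℝ => nc.Φ q₀ + t • d := by fun_prop
  have hγ' : ∀ t : ℝ, HasDerivAt (fun t : ℝ => nc.Φ q₀ + t • d) d t := fun t => by
    simpa using ((hasDerivAt_id t).smul_const d).const_add (nc.Φ q₀)
  obtain ⟨e, he⟩ := (isCompact_Icc (a := (0 : ℝ)) (b := 1)).exists_bound_of_continuousOn
    (f := fun t : ℝ => g.chart.form (nc.Φ q₀ + t • d) d d)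
    ((((g.chart.smooth.continuous.comp hγ).clm_apply continuous_const).clm_apply
      continuous_const).continuousOn)
  set C := Real.sqrt e
  set S := max (R + 1) (C - q₀.1)
  have hS : R < S := (lt_add_one R).trans_le (le_max_left _ _)
  have hwarp : 0 < Metric.warp β (-S) := Real.exp_pos _
  set C' := Real.sqrt (e / Metric.warp β (-S))
  refine exists_lift_of_compact (nc.isLocalHomeomorph_Φ hR hw hβ hK) hγ (by simp)
    (isCompact_closedBall q₀ (max C C')) ?_
  intro T hT Γ hΓc hΓ0 hΓ
  choose! u hu hdu using fun t (ht : t ∈ Icc 0 T) => nc.hasDerivWithinAt_lift hR hw hβ hK ht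
    (hΓc t ht) (hγ' t).hasDerivWithinAt hΓ
  have hE : ∀ t ∈ Icc 0 T, (u t).1 ^ 2 +
      g.chart.form (nc.Φ (Γ t)) (nc.J (Γ t) (u t).2) (nc.J (Γ t) (u t).2) ≤ e := fun t ht => by
    rw [← nc.form_dΦ hR hw, hdu t ht, hΓ t ht]
    exact (le_abs_self _).trans (he t ⟨ht.1, ht.2.trans hT.2⟩)
  have hs : ∀ t ∈ Icc 0 T, ‖(Γ t).1 - q₀.1‖ ≤ C := fun t ht => by
    have := norm_image_sub_le_of_norm_deriv_le_segment' (f := fun t => (Γ t).1) (C := C)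
      (fun t ht => (hu t ht).fst) (fun t ht => Real.abs_le_sqrt (by
        have := g.chart.self_nonneg (nc.Φ (Γ t)) (nc.J (Γ t) (u t).2)
        linarith [hE t (Ico_subset_Icc_self ht)])) t ht
    rw [hΓ0] at this
    refine this.trans (mul_le_of_le_one_right (Real.sqrt_nonneg _) ?_)
    linarith [ht.2, hT.2]
  have hy : ∀ t ∈ Icc 0 T, ‖(Γ t).2 - q₀.2‖ ≤ C' := fun t ht => by
    have := norm_image_sub_le_of_norm_deriv_le_segment' (f := fun t => (Γ t).2) (C := C')
      (fun t ht => (hu t ht).snd) (fun t ht => Real.le_sqrt_of_sq_le (by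
        have ht' := Ico_subset_Icc_self ht
        have h1 := abs_le.1 (hs t ht')
        have h2 := nc.le_form_J_J hR hw hβ hK hS (q := Γ t)
          (by linarith [h1.1, le_max_right (R + 1) (C - q₀.1)]) (u t).2
        rw [le_div_iff₀ hwarp, mul_comm]
        linarith [hE t ht', sq_nonneg (u t).1])) t ht
    rw [hΓ0] at this
    refine this.trans (mul_le_of_le_one_right (Real.sqrt_nonneg _) ?_)
    linarith [ht.2, hT.2]
  rw [mem_closedBall_iff_norm]
  exact max_le_max (hs T ⟨hT.1, le_rfl⟩) (hy T ⟨hT.1, le_rfl⟩)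

include hR hw hβ hK in
theorem exists_inverse : ∃ Ψ : Cover n → Cover n, Continuous Ψ ∧ (∀ p, nc.Φ (Ψ p) = p) ∧
    ∀ q, Ψ (nc.Φ q) = q :=
  exists_continuous_inverse_of_lift (nc.isLocalHomeomorph_Φ hR hw hβ hK) 0
    (nc.exists_segment_lift hR hw hβ hK 0)

include hR hw hβ hK in
/-- Along a geodesic `x = Φ ∘ q`, the height `(q t).1` has second derivative `g(∇J, J)`, where
`J` is the horospherical component of the velocity. -/
theorem exists_height_derivs {x q : ℝ → Cover n} (hx : g.IsLiftedGeodesic x)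
    (hq : Continuous q) (hxq : ∀ t, nc.Φ (q t) = x t) :
    ∃ u : ℝ → Cover n, (∀ t, HasDerivAt q (u t) t) ∧ (∀ t, HasDerivAt x (nc.dΦ (q t) (u t)) t) ∧
      ∀ t, HasDerivAt (fun t => (u t).1)
        (g.chart.form (nc.Φ (q t)) (nc.covJ (q t) (u t).2) (nc.J (q t) (u t).2)) t := by
  obtain ⟨v, hv, hv'⟩ := hx
  choose u hu hdu using fun t => nc.hasDerivWithinAt_lift hR hw hβ hK (mem_univ t)
    (hq.continuousAt.continuousWithinAt) (hv t).hasDerivWithinAt (fun t _ => hxq t)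
  simp only [hasDerivWithinAt_univ] at hu
  refine ⟨u, hu, fun t => by rw [hdu]; exact hv t, fun t => ?_⟩
  have hN : HasDerivAt (fun t => nc.N (q t)) _ t :=
    (nc.hasStrictFDerivAt_N (q t)).hasFDerivAt.comp_hasDerivAt t (hu t)
  have hvt : HasDerivAt v (-g.chart.christoffel (x t) (v t) (v t)) t := hv' t
  have h := g.chart.hasDerivAt_form_along (hv t) hvt hN
  have hu1 : (fun t => (u t).1) = fun t => g.chart.form (x t) (v t) (nc.N (q t)) := by
    funext t
    rw [← hdu, ← hxq, nc.form_N_dΦ hR hw]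
  rw [hu1]
  refine h.congr_deriv ?_
  -- The height has derivative g(x', N). In the covariant derivative of N along x the component
  -- along N drops out because ∇_N N = 0, which leaves ∇J.
  have hcov : ((ContinuousLinearMap.toSpanSingleton ℝ (-g.chart.christoffel (nc.Φ (q t))
      (nc.N (q t)) (nc.N (q t)))).coprod (nc.W (q t))) (u t) +
      g.chart.christoffel (x t) (v t) (nc.N (q t)) = nc.covJ (q t) (u t).2 := by
    rw [covJ, ← hdu t, ← hxq t, dΦ_apply, g.chart.christoffel_symm _ (nc.N (q t)) (nc.J (q t) (u t).2)]
    simp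
    module
  rw [hcov, neg_add_cancel, ← hxq t]
  have h0 := nc.form_N_covJ hR hw (q t) (u t).2
  nth_rewrite 1 [← hdu t]
  rw [dΦ_apply, g.chart.symm _ (nc.covJ _ _)]
  simp [h0]

end NormalCoordinates

/-- A differentiable function with monotone derivative that is bounded on `ℝ` has zero
derivative. -/
theorem eq_zero_of_monotone_deriv_of_bounded {f f' : ℝ → ℝ} (hf : ∀ t, HasDerivAt f (f' t) t)
    (hmono : Monotone f') {M : ℝ} (hM : ∀ t, |f t| ≤ M) (t : ℝ) : f' t = 0 := by
  have hM0 : 0 ≤ M := (abs_nonneg _).trans (hM 0)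
  have hcont : Continuous f := continuous_iff_continuousAt.2 fun t => (hf t).continuousAt
  rcases lt_trichotomy (f' t) 0 with h | h | h
  · exfalso
    -- Over this length the slope changes f by at least 2M + 1, more than the bound M on |f| allows.
    have hpos : 0 < (2 * M + 1) / -f' t := div_pos (by linarith) (by linarith)
    obtain ⟨ξ, hξ, hs⟩ := exists_hasDerivAt_eq_slope f f'
      (show t - (2 * M + 1) / -f' t < t by linarith) hcont.continuousOn (fun s _ => hf s)
    have h1 := hmono hξ.2.le
    rw [hs, sub_sub_cancel, div_le_iff₀ hpos] at h1
    have h2 : f' t * ((2 * M + 1) / -f' t) = -(2 * M + 1) := by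
      have := h.ne
      field_simp
    have := abs_le.1 (hM t)
    have := abs_le.1 (hM (t - (2 * M + 1) / -f' t))
    linarith
  · exact h
  · exfalso
    have hpos : 0 < (2 * M + 1) / f' t := by positivity
    obtain ⟨ξ, hξ, hs⟩ := exists_hasDerivAt_eq_slope f f'
      (show t < t + (2 * M + 1) / f' t by linarith) hcont.continuousOn (fun s _ => hf s)
    have h1 := hmono hξ.1.le
    rw [hs, add_sub_cancel_left, le_div_iff₀ hpos] at h1
    have h2 : f' t * ((2 * M + 1) / f' t) = 2 * M + 1 := by field_simp
    have := abs_le.1 (hM t)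
    have := abs_le.1 (hM (t + (2 * M + 1) / f' t))
    linarith

end CuspFunnel

end

/-! ### Riemannian distance, and the conclusion -/

noncomputable section

set_option maxSynthPendingDepth 3

namespace CuspFunnel

open Set MeasureTheory

variable {n : ℕ} {c : Fin n → EuclideanSpace ℝ (Fin n)}

namespace Metric

/-- The length of a curve is at least √m times the variation of its r-coordinate. -/
theorem le_riemDist (g : Metric c) {m : ℝ} (hm : 0 < m)
    (hr : ∀ x v : Cover n, m * v.1 ^ 2 ≤ g.lift x v v) (p q : Cylinder c) :
    ENNReal.ofReal (Real.sqrt m * |q.1 - p.1|) ≤ g.riemDist p q := by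
  refine le_iInf₂ fun x hx => ?_
  obtain ⟨hx1, hxp, hxq⟩ := hx
  have hd : ∀ t, HasDerivAt x (deriv x t) t := fun t =>
    (hx1.differentiable one_ne_zero t).hasDerivAt
  have hc : Continuous fun t => (deriv x t).1 := (hx1.continuous_deriv le_rfl).fst
  have hint : ∫ t in (0 : ℝ)..1, Real.sqrt m * (deriv x t).1 = Real.sqrt m * (q.1 - p.1) := by
    rw [intervalIntegral.integral_const_mul, intervalIntegral.integral_eq_sub_of_hasDerivAt
      (f := fun t => (x t).1) (fun t _ => (hd t).fst) (hc.intervalIntegrable 0 1), ← hxp, ← hxq]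
    rfl
  calc ENNReal.ofReal (Real.sqrt m * |q.1 - p.1|)
      = ‖∫ t in (0 : ℝ)..1, Real.sqrt m * (deriv x t).1‖ₑ := by
        rw [hint, Real.enorm_eq_ofReal_abs, abs_mul, abs_of_nonneg (Real.sqrt_nonneg m)]
    _ ≤ ∫⁻ t in Ioc (0 : ℝ) 1, ‖Real.sqrt m * (deriv x t).1‖ₑ := by
        rw [intervalIntegral.integral_of_le zero_le_one]
        exact enorm_integral_le_lintegral_enorm _
    _ ≤ ∫⁻ t in Icc (0 : ℝ) 1, ‖Real.sqrt m * (deriv x t).1‖ₑ :=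
        lintegral_mono_set Ioc_subset_Icc_self
    _ ≤ g.length x := by
        refine lintegral_mono fun t => ?_
        rw [Real.enorm_eq_ofReal_abs]
        refine ENNReal.ofReal_le_ofReal (Real.abs_le_sqrt ?_)
        rw [mul_pow, Real.sq_sqrt hm.le]
        exact hr _ _

theorem exists_bound_of_isBounded (g : Metric c) {m : ℝ} (hm : 0 < m)
    (hr : ∀ x v : Cover n, m * v.1 ^ 2 ≤ g.lift x v v) {A : Set (Cylinder c)}
    (hA : g.IsBounded A) : ∃ M, ∀ p ∈ A, |p.1| ≤ M := by
  rcases A.eq_empty_or_nonempty with rfl | ⟨p, hp⟩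
  · exact ⟨0, by simp⟩
  obtain ⟨C, hC, hd⟩ := hA
  have hm' : 0 < Real.sqrt m := Real.sqrt_pos.2 hm
  refine ⟨|p.1| + C.toReal / Real.sqrt m, fun q hq => ?_⟩
  have h1 := ((g.le_riemDist hm hr p q).trans (hd p hp q hq))
  have h2 := (ENNReal.ofReal_le_iff_le_toReal hC.ne).1 h1
  have h3 : |q.1 - p.1| ≤ C.toReal / Real.sqrt m := by
    rw [le_div_iff₀ hm', mul_comm]
    exact h2
  have h4 := abs_sub_abs_le_abs_sub q.1 p.1
  linarith

end Metric

/-- The flat metric on the torus. -/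
def flatTorusMetric (c : Fin n → EuclideanSpace ℝ (Fin n)) : TorusMetric c where
  form _ := innerSL ℝ
  smooth := contDiff_const
  symm _ u v := real_inner_comm v u
  pos _ _ hu := real_inner_self_pos.2 hu

/-- A metric on the cylinder which is warped for `|r| > R` and nonpositively curved for `|r| ≤ R`
satisfies the assumptions. -/
theorem assumptions_of_nonposCurved (hc : LinearIndependent ℝ c) {R : ℝ} {β : ℝ → ℝ} (hR : 0 < R)
    (hβ : Admissible β R) (g : Metric c)
    (hw : ∀ p : Cylinder c, R < |p.1| → ∀ u v : Cover n,
      g.form p u v = warpedForm p.1 (β p.1) u v)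
    (hneg : g.NonposCurvedOver {r : ℝ | |r| ≤ R}) : Assumptions g R := by
  have hK := Metric.curvature_nonpos hw hβ hneg
  obtain ⟨m, hm, hr⟩ := Metric.exists_le_lift hw hc
  have hb := g.noBlowUp_geodesicField hc hm hr
  have hf1 : ContDiff ℝ 1 g.chart.geodesicField := g.chart.contDiff_geodesicField.of_le
    (WithTop.coe_le_coe.2 le_top)
  obtain ⟨nc⟩ := exists_normalCoordinates hR hβ.smooth hb hw
  obtain ⟨Ψ, hΨ, hΦΨ, hΨΦ⟩ := nc.exists_inverse hR hw hβ hK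
  have hpos : ∀ q w, 0 ≤ g.chart.form (nc.Φ q) (nc.covJ q w) (nc.J q w) := fun q w => by
    rcases eq_or_ne w 0 with rfl | h
    · simp
    · exact (nc.form_covJ_J_pos hR hw hβ hK q h).le
  -- The cusp is a sublevel set of the height, because Φ is the identity there and injective
  -- everywhere.
  have hcusp : ∀ p : Cover n, (Ψ p).1 < -R ↔ p.1 < -R := fun p => by
    constructor
    · intro h
      rw [← hΦΨ p, nc.Φ_of_lt _ h]
      exact h
    · intro h
      rw [← nc.Φ_of_lt p h, hΨΦ]
      exact h
  refine ⟨hR, ⟨β, flatTorusMetric c, flatTorusMetric c, hβ, ?_, ?_⟩, ?_, ?_, ?_⟩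
  · exact fun p hp u v => hw p (hp.trans_le (le_abs_self _)) u v
  · exact fun p hp u v => hw p ((lt_neg_of_lt_neg hp).trans_le (neg_le_abs _)) u v
  · intro x v
    obtain ⟨F, hF⟩ := hb.exists_isFlow hf1
    refine ⟨fun t => (F t (x, v)).1, g.isLiftedGeodesic_of_integralCurve (hF.deriv (x, v)), ?_, ?_⟩
    · simp only [hF.zero]
    · have h : HasDerivAt (fun t => (F t (x, v)).1) (F 0 (x, v)).2 0 := (hF.deriv (x, v) 0).fst
      rw [h.deriv, hF.zero]
  · rintro γ ⟨x, hx, hγ⟩ ⟨t₁, t₂, hne⟩ hbd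
    obtain ⟨M, hM⟩ := g.exists_bound_of_isBounded hm hr hbd
    have hxM : ∀ t, |(x t).1| ≤ M := fun t => by
      simpa [hγ, proj] using hM _ (mem_range_self t)
    -- Φ commutes with lattice translations, so the height is lattice invariant.
    obtain ⟨M', hM'⟩ := exists_bound_of_periodic hc (f := fun p => (Ψ p).1) hΨ.fst
      (fun p l hl => by
        have h1 : ((p.1, p.2 - l) : Cover n) = nc.Φ (Ψ p - (0, l)) := by
          rw [nc.Φ_sub_lattice _ l hl, hΦΨ]
          simp [Prod.sub_def]
        rw [h1, hΨΦ]
        simp) M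
    have hxc : Continuous x := by
      obtain ⟨v, hv, -⟩ := hx
      exact continuous_iff_continuousAt.2 fun t => (hv t).continuousAt
    obtain ⟨u, hu, hxu, hu'⟩ := nc.exists_height_derivs hR hw hβ hK hx (hΨ.comp hxc)
      (fun t => hΦΨ (x t))
    have h1 := eq_zero_of_monotone_deriv_of_bounded (fun t => (hu t).fst)
      (monotone_of_hasDerivAt_nonneg hu' fun t => hpos _ _) (fun t => hM' _ (hxM t))
    -- The height has zero derivative, so its second derivative g(∇J, J) vanishes too; strict
    -- positivity excludes a horospherical component.
    have h2 : ∀ t, (u t).2 = 0 := fun t => by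
      by_contra hne0
      have h3 := hu' t
      simp only [h1] at h3
      exact (nc.form_covJ_J_pos hR hw hβ hK _ hne0).ne' (h3.unique (hasDerivAt_const t 0))
    have h3 : ∀ t, HasDerivAt x 0 t := fun t => by
      have := hxu t
      rwa [show u t = 0 from Prod.ext (h1 t) (h2 t), map_zero] at this
    have h4 := is_const_of_deriv_eq_zero (fun t => (h3 t).differentiableAt)
      (fun t => (h3 t).deriv) t₁ t₂
    exact hne (by rw [hγ, hγ, h4])
  · rintro γ ⟨x, hx, hγ⟩ -
    have hxc : Continuous x := by
      obtain ⟨v, hv, -⟩ := hx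
      exact continuous_iff_continuousAt.2 fun t => (hv t).continuousAt
    obtain ⟨u, hu, hxu, hu'⟩ := nc.exists_height_derivs hR hw hβ hK hx (hΨ.comp hxc)
      (fun t => hΦΨ (x t))
    have hs : ∀ t, HasDerivAt (fun t => (Ψ (x t)).1) (u t).1 t := fun t => (hu t).fst
    have hconv : ConvexOn ℝ univ fun t => (Ψ (x t)).1 := by
      refine Monotone.convexOn_univ_of_deriv (fun t => (hs t).differentiableAt) ?_
      rw [show deriv (fun t => (Ψ (x t)).1) = fun t => (u t).1 from funext fun t => (hs t).deriv]
      exact monotone_of_hasDerivAt_nonneg hu' fun t => hpos _ _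
    have hset : γ ⁻¹' {p | p.1 < -R} = {t ∈ univ | (Ψ (x t)).1 < -R} := by
      ext t
      simp [hcusp, hγ, proj]
    rw [hset]
    exact (hconv.convex_lt (-R)).isPreconnected

theorem admissible_zero (R : ℝ) : Admissible (fun _ => 0) R where
  smooth := contDiff_const
  holomorphic := ⟨Real.pi / 8, by positivity, by linarith [Real.pi_pos], fun _ => 0,
    differentiableOn_const 0, ⟨0, by simp⟩, by simp⟩
  small r := by simp

theorem linearIndependent_unitTranslation : LinearIndependent ℝ unitTranslation := by
  rw [linearIndependent_unique_iff]
  simp [unitTranslation]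

end CuspFunnel

end

open CuspFunnel in
theorem mainTheorem5 :
    (∀ (n : ℕ) (c : Fin n → EuclideanSpace ℝ (Fin n)), LinearIndependent ℝ c →
      ∀ (R : ℝ) (β : ℝ → ℝ), 0 < R → Admissible β R →
      ∀ g : Metric c,
        (∀ p : Cylinder c, R < |p.1| → ∀ u v : Cover n,
          g.form p u v = warpedForm p.1 (β p.1) u v) →
        g.NonposCurvedOver {r : ℝ | |r| ≤ R} →
        Assumptions g R) ∧
    (∀ g : Metric unitTranslation,
      (∃ K : Set (Cylinder unitTranslation), IsCompact K ∧
        ∀ p : Cylinder unitTranslation, p ∉ K → ∀ u v : Cover 1,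
          g.form p u v = warpedForm p.1 0 u v) →
      g.NonposCurvedOver Set.univ →
      ∃ R : ℝ, Assumptions g R) := by
  refine ⟨fun n c hc R β hR hβ g hw hneg => assumptions_of_nonposCurved hc hR hβ g hw hneg,
    fun g ⟨K, hK, hg⟩ hneg => ?_⟩
  obtain ⟨M, hM⟩ := hK.exists_bound_of_continuousOn
    (continuous_fst : Continuous fun p : Cylinder unitTranslation => p.1).continuousOn
  -- |r| is at most M on the compact set, so the metric is hyperbolic beyond it; the 1 keeps the
  -- constant positive.
  refine ⟨max M 1, assumptions_of_nonposCurved (β := fun _ => 0) linearIndependent_unitTranslation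
    (by positivity) (admissible_zero _) g (fun p hp u v => hg p (fun hpK => ?_) u v)
    (fun x _ => hneg x (Set.mem_univ _))⟩
  exact absurd ((hM p hpK).trans (le_max_left M 1)) (not_le.2 hp)
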